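/- Work in exact de Sitter space, with scale factor $a(\tau)=-1/(H\tau)$, $H>0$, conformal time $\tau\in(-\infty,0)$, and massless scalars with bulk-to-boundary propagator $K(k,\tau)=(1-ik\tau)e^{ik\tau}$ and bulk-to-bulk propagator $$G(k,\tau_1,\tau_2)=\tfrac{H^2}{2k^3}\Big[(1+ik\tau_1)(1-ik\tau_2)e^{-ik(\tau_1-\tau_2)}\Theta(\tau_1-\tau_2)+(\tau_1\leftrightarrow\tau_2)-(1-ik\tau_1)(1-ik\tau_2)e^{ik(\tau_1+\tau_2)}\Big].$$ A P-odd (hence CP-odd) local operator with $N$ fields is $g\,a^{1-2m-n}\epsilon^{(3)}\partial_i^{3+2m}\partial_\tau^n\varphi^N$ with $g\in\mathbb R$: three spatial derivatives are contracted with $\epsilon^{ijk}$, the other $2m$ are contracted in pairs, and the $n$ time derivatives and all spatial derivatives are distributed among the $N$ fields in any way. A P-even one is $g\,a^{4-2m-n}\partial_i^{2m}\partial_\tau^n\varphi^N$. The contribution of a connected tree diagram with $E$ external lines to the wavefunction coefficient $\tilde\psi_E(k_1,\dots,k_E)$ is $$\lim_{\varepsilon\to0^+}\int_{-\infty(1-i\varepsilon)}^0\prod_v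 i\,d\tau_v\,D_v\prod_{\text{ext}}K\prod_{\text{int}}G ,$$ where $D_v$ is the operator at the vertex $v$ (with $\partial_j\mapsto ik_j$), and time derivatives also act on the step functions in $G$. Put $\mathrm{Re}'\psi(k)=\frac12\big(\psi(k)+\psi(-k)^*\big)$ and $P(k)=H^2/(2k^3)$. The correlator generated by $\tilde\psi_N$ is $\langle\varphi^N\rangle'=-2\,\mathrm{Re}'\tilde\psi_N\prod_{i=1}^NP(k_i)$, the trispectrum if $N=4$. Say that a coefficient $\tilde\psi_N$ is a pure phase (on a region of momenta) if, for every real Schwartz boundary field $\varphi$, the factor $\exp\big(-\frac1{N!}\int\tilde\psi_N\,\varphi_{k_1}\cdots\varphi_{k_N}\big)$ (the integral being over momenta with $\sum k_i=0$ in the region) has modulus $1$, so that for every remaining factor $\Psi_0$ of the wavefunction, every functional $A$ and every measure $\mathcal D\varphi$ the expectation value $\int\mathcal D\varphi\,|\Psi|^2A\big/\int\mathcal D\varphi\,|\Psi|^2$ is unchanged when the factor is included in $\Psi$. Then: 1. *Contact diagrams.* For a P-odd operator with $2m+n>0$ and non-zero external momenta, the time integral of each contraction converges absolutely and the limit $\varepsilon\to0^+$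 exists. Each contraction, and their sum $\tilde\psi_N$ over all contractions, is real and P-odd: $\tilde\psi_N(-k)=-\tilde\psi_N(k)$. Hence $\mathrm{Re}'\tilde\psi_N=0$ and $\langle\varphi^N\rangle'=0$; also the in-in (Schwinger–Keldysh) contact diagram, time-ordered plus anti-time-ordered, vanishes. The momentum integral $\int\tilde\psi_N\varphi^N$ converges absolutely for every Schwartz $\varphi$, and $\tilde\psi_N$ is a pure phase on all of momentum space. 2. *Connected tree diagrams.* Consider a connected tree diagram of P-odd and P-even operators with an odd number of P-odd vertices, at momenta such that all external and internal lines carry non-zero momentum. If its time integrals converge absolutely (locally uniformly in the direction of the rotated contour), then the limit exists, its value is real and P-odd, and $\mathrm{Re}'$ of it and the correlator it generates vanish. Convergence is automatic when no vertex carries a positive power of $a$ (that is, $2m+n\ge1$ at P-odd and $2m+n\ge4$ at P-even vertices), whatever the number of P-odd vertices. Every finite real linear combination of such diagrams is a pure phase on every measurable momentum region, symmetric under $k\to-k$, on which all lines carry non-zero momentum and the time integrals converge. 3. *Trispectrum.* For any finite collection of P-odd four-scalar operators with $2m+n>0$ and non-zero external momenta, the contact trispectrum (from the wavefunction, and from the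 in-in diagrams) vanishes; in particular it has no P-odd imaginary part. -/

import Mathlib

namespace DeSitter

open MeasureTheory Filter Topology
open scoped SchwartzMap

noncomputable section

/-- Comoving three-momenta (and comoving positions). -/
abbrev Vec3 := EuclideanSpace ℝ (Fin 3)

/-! ### Local operators -/

/-- A local, rotation- and dilation-invariant monomial in `N` massless scalars (the factors are
labelled, so flavours may or may not coincide): a real coupling times
`a ^ scalePower * ∏ ∂_i … ∂_τ ^ (n_j) φ_j`.
* `eps = some t`: three spatial derivatives, on the factors `t 0, t 1, t 2`, are contracted with the
  Levi-Civita symbol (a parity-odd operator); `eps = none`: no Levi-Civita symbol (parity-even).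
* `2 * m` further spatial derivatives are contracted in pairs with Kronecker deltas; the `l`-th
  pair acts on the factors `(contr l).1` and `(contr l).2` (possibly the same one).
* `timeDeriv j` conformal-time derivatives act on the factor `j`. -/
structure LocalOperator (N : ℕ) where
  coupling : ℝ
  eps : Option (Fin 3 → Fin N)
  m : ℕ
  contr : Fin m → Fin N × Fin N
  timeDeriv : Fin N → ℕ

namespace LocalOperator

variable {N : ℕ}

/-- The operator is P-odd (hence CP-odd, the scalars being C-even). -/
def IsOdd (O : LocalOperator N) : Prop := O.eps.isSome = true

/-- The total number of time derivatives. -/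
def n (O : LocalOperator N) : ℕ := ∑ j, O.timeDeriv j

/-- The power of the scale factor, `√-g` included: `1 - 2m - n` for a P-odd operator and
`4 - 2m - n` for a P-even one, as dilation invariance dictates. -/
def scalePower (O : LocalOperator N) : ℤ :=
  match O.eps with
  | none => 4 - 2 * (O.m : ℤ) - (O.n : ℤ)
  | some _ => 1 - 2 * (O.m : ℤ) - (O.n : ℤ)

/-- The spatial derivatives in momentum space, `∂_i ↦ i p_i`, when the factor `j` has momentum
`p j`.  The determinant is `ε^{ijk} p_i p'_j p''_k`. -/
def spatial (O : LocalOperator N) (p : Fin N → Vec3) : ℂ :=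
  (match O.eps with
    | none => 1
    | some t =>
        Complex.I ^ 3 * ((Matrix.det (Matrix.of fun (a i : Fin 3) => p (t a) i) : ℝ) : ℂ)) *
    (Complex.I ^ (2 * O.m) *
      ((∏ l, inner ℝ (p (O.contr l).1) (p (O.contr l).2) : ℝ) : ℂ))

end LocalOperator

/-! ### De Sitter space: scale factor, propagators, time contours -/

/-- The exact de Sitter scale factor `a(τ) = -1/(Hτ)`. -/
def scaleFactor (H : ℝ) (τ : ℂ) : ℂ := -1 / ((H : ℂ) * τ)

/-- Bulk-to-boundary propagator of a massless scalar. -/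
def bulkToBoundary (k : ℝ) (τ : ℂ) : ℂ :=
  (1 - Complex.I * k * τ) * Complex.exp (Complex.I * k * τ)

/-- Bulk-to-bulk propagator of a massless scalar (Dirichlet condition at `τ = 0`), for a time `τ₁`
that is later than `τ₂`; for the other ordering exchange the two times. -/
def bulkToBulk (H k : ℝ) (τ₁ τ₂ : ℂ) : ℂ :=
  (H : ℂ) ^ 2 / (2 * (k : ℂ) ^ 3) *
    ((1 + Complex.I * k * τ₁) * (1 - Complex.I * k * τ₂) *
        Complex.exp (-Complex.I * k * (τ₁ - τ₂)) -
      (1 - Complex.I * k * τ₁) * (1 - Complex.I * k * τ₂) *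
        Complex.exp (Complex.I * k * (τ₁ + τ₂)))

/-- `∫ f(τ) dτ` along the ray `τ = s ω` from `s = ∞` (far past) to `s = 0` (future boundary). -/
def rayIntegral (ω : ℂ) (f : ℂ → ℂ) : ℂ :=
  -∫ s in Set.Ioi (0 : ℝ), ω * f ((s : ℂ) * ω)

/-- The direction of the regulated contour `∫_{-∞(1-iε)}^0 dτ`. -/
def contour (ε : ℝ) : ℂ := -(1 - Complex.I * ε)

/-- Away from `τ' = τ`: the derivative `∂_{τ'}^b G(k, τ, τ')` at `τ' = s τ`.
On a contour, `s τ` is earlier than `τ` when `s > 1` and later when `s < 1`. -/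
def bulkDeriv (H k : ℝ) (b : ℕ) (τ : ℂ) (s : ℝ) : ℂ :=
  if 1 < s then iteratedDeriv b (fun τ' => bulkToBulk H k τ τ') ((s : ℂ) * τ)
  else iteratedDeriv b (fun τ' => bulkToBulk H k τ' τ) ((s : ℂ) * τ)

/-- The jump of `∂_{τ'}^j G(k, τ, τ')` when `τ'` increases through `τ`. -/
def bulkJump (H k : ℝ) (j : ℕ) (τ : ℂ) : ℂ :=
  iteratedDeriv j (fun τ' => bulkToBulk H k τ' τ) τ -
    iteratedDeriv j (fun τ' => bulkToBulk H k τ τ') τ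

/-- `∫ dτ' (∂_{τ'}^b G)(k, τ, τ') S(τ')` along the ray through `τ`, with `∂_{τ'}^b G` the
distributional derivative: the time-ordering step functions are differentiated too, that is,
`∂_{τ'}^b G = {∂_{τ'}^b G} + ∑_{j<b} (jump of ∂_{τ'}^j G) δ^{(b-1-j)}(τ' - τ)`. -/
def propagate (H k : ℝ) (b : ℕ) (S : ℂ → ℂ) (τ : ℂ) : ℂ :=
  -(∫ s in Set.Ioi (0 : ℝ), τ * (bulkDeriv H k b τ s * S ((s : ℂ) * τ))) +
    ∑ j ∈ Finset.range b, (-1) ^ (b - 1 - j) * bulkJump H k j τ * iteratedDeriv (b - 1 - j) S τ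

/-- The factor `i · coupling · a^{scalePower} · (spatial derivatives)` of a vertex. -/
def vertexFactor {N : ℕ} (H : ℝ) (O : LocalOperator N) (p : Fin N → Vec3) (τ : ℂ) : ℂ :=
  Complex.I * O.coupling * O.spatial p * scaleFactor H τ ^ O.scalePower

/-! ### Tree diagrams -/

/-- A branch of a tree diagram with external lines labelled by `Fin E`: an external line, or an
internal line that ends (away from the root) on a vertex.  The factor `0` of the operator at this
vertex is contracted with that internal line, the factors `i.succ` with the branches `legs i`. -/
inductive Branch (E : ℕ) : Type
  | external (e : Fin E) : Branch E
  | vertex (N : ℕ) (O : LocalOperator (N + 1)) (legs : Fin N → Branch E) : Branch E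

namespace Branch

variable {E : ℕ}

/-- How often the external line `e` occurs in the branch. -/
def count (e : Fin E) : Branch E → ℕ
  | external e' => if e' = e then 1 else 0
  | vertex _ _ legs => ∑ i, (legs i).count e

/-- The number of P-odd vertices. -/
def numOdd : Branch E → ℕ
  | external _ => 0
  | vertex _ O legs => (if O.eps.isSome then 1 else 0) + ∑ i, (legs i).numOdd

/-- No vertex has a positive power of the scale factor. -/
def NonposPowers : Branch E → Prop
  | external _ => True
  | vertex _ O legs => O.scalePower ≤ 0 ∧ ∀ i, (legs i).NonposPowers

/-- The momentum that flows through the branch towards the root. -/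
def momentum (k : Fin E → Vec3) : Branch E → Vec3
  | external e => k e
  | vertex _ _ legs => ∑ i, (legs i).momentum k

/-- All lines of the branch carry non-zero momentum. -/
def Generic (k : Fin E → Vec3) : Branch E → Prop
  | external e => k e ≠ 0
  | vertex _ _ legs => (∑ i, (legs i).momentum k) ≠ 0 ∧ ∀ i, (legs i).Generic k

/-- The contribution of the branch as a function of the time `τ` at its root end: the
bulk-to-boundary propagator of an external line; for an internal line, the bulk-to-bulk propagator
contracted with the vertex at its far end, whose time is integrated along the ray through `τ`. -/
def field (H : ℝ) (k : Fin E → Vec3) : Branch E → ℂ → ℂ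
  | external e => bulkToBoundary ‖k e‖
  | vertex _ O legs =>
      propagate H ‖∑ i, (legs i).momentum k‖ (O.timeDeriv 0) fun τ =>
        vertexFactor H O
            (Fin.cons (-∑ i, (legs i).momentum k) fun i => (legs i).momentum k) τ *
          ∏ i, iteratedDeriv (O.timeDeriv i.succ) ((legs i).field H k) τ

/-- All time integrals in the branch converge absolutely, locally uniformly with respect to the
time at the root end (in the half-plane of contour directions with decaying `e^{ikτ}`). -/
def Converges (H : ℝ) (k : Fin E → Vec3) : Branch E → Prop
  | external _ => True
  | vertex _ O legs =>
      (∀ i, (legs i).Converges H k) ∧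
      ∀ τ₀ : ℂ, 0 < τ₀.im → ∃ g : ℝ → ℝ, IntegrableOn g (Set.Ioi 0) ∧
        ∀ᶠ τ in 𝓝 τ₀, ∀ s : ℝ, 0 < s →
          ‖bulkDeriv H ‖∑ i, (legs i).momentum k‖ (O.timeDeriv 0) τ s *
            (vertexFactor H O
                (Fin.cons (-∑ i, (legs i).momentum k) fun i => (legs i).momentum k)
                ((s : ℂ) * τ) *
              ∏ i, iteratedDeriv (O.timeDeriv i.succ) ((legs i).field H k) ((s : ℂ) * τ))‖ ≤ g s

end Branch

/-- A connected tree diagram with external lines labelled by `Fin E`, seen from one of its vertices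
(the root): the factor `i` of the operator there is contracted with the branch `legs i`. -/
structure TreeDiagram (E : ℕ) where
  N : ℕ
  O : LocalOperator N
  legs : Fin N → Branch E
  each_once : ∀ e, ∑ i, (legs i).count e = 1

namespace TreeDiagram

variable {E : ℕ}

/-- The number of P-odd vertices. -/
def numOdd (D : TreeDiagram E) : ℕ :=
  (if D.O.eps.isSome then 1 else 0) + ∑ i, (D.legs i).numOdd

/-- No vertex has a positive power of the scale factor: `2m + n ≥ 1` at the P-odd vertices and
`2m + n ≥ 4` at the P-even ones. -/
def NonposPowers (D : TreeDiagram E) : Prop :=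
  D.O.scalePower ≤ 0 ∧ ∀ i, (D.legs i).NonposPowers

/-- All external and internal lines carry non-zero momentum. -/
def Generic (D : TreeDiagram E) (k : Fin E → Vec3) : Prop := ∀ i, (D.legs i).Generic k

/-- The integrand of the time integral at the root. -/
def integrand (H : ℝ) (D : TreeDiagram E) (k : Fin E → Vec3) (τ : ℂ) : ℂ :=
  vertexFactor H D.O (fun i => (D.legs i).momentum k) τ *
    ∏ i, iteratedDeriv (D.O.timeDeriv i) ((D.legs i).field H k) τ

/-- All time integrals of the diagram converge absolutely, locally uniformly with respect to the
direction of the contour. -/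
def Converges (H : ℝ) (D : TreeDiagram E) (k : Fin E → Vec3) : Prop :=
  (∀ i, (D.legs i).Converges H k) ∧
  ∀ ω₀ : ℂ, 0 < ω₀.im → ∃ g : ℝ → ℝ, IntegrableOn g (Set.Ioi 0) ∧
    ∀ᶠ ω in 𝓝 ω₀, ∀ s : ℝ, 0 < s → ‖D.integrand H k ((s : ℂ) * ω)‖ ≤ g s

/-- The diagram `∫ ∏_v i dτ_v D_v ∏ K ∏ G`, all times on the ray of direction `ω`. -/
def regulated (H : ℝ) (D : TreeDiagram E) (k : Fin E → Vec3) (ω : ℂ) : ℂ :=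
  rayIntegral ω (D.integrand H k)

/-- The contribution of the diagram to the wavefunction coefficient `ψ̃_E(k)`: the limit `ε → 0⁺`
of the diagram on the contours `∫_{-∞(1-iε)}^0`. -/
def psi (H : ℝ) (D : TreeDiagram E) (k : Fin E → Vec3) : ℂ :=
  limUnder (𝓝[>] (0 : ℝ)) fun ε : ℝ => D.regulated H k (contour ε)

/-- The one-vertex diagram in which the factor `i` of `O` is contracted with the external line
`σ i`. -/
def contact {N : ℕ} (O : LocalOperator N) (σ : Equiv.Perm (Fin N)) : TreeDiagram N where
  N := N
  O := O
  legs := fun i => Branch.external (σ i)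
  each_once := by
    intro e
    have h : ∀ i, (if σ i = e then 1 else 0) = (if i = σ.symm e then 1 else 0 : ℕ) := by
      intro i
      simp [Equiv.eq_symm_apply]
    simp [Branch.count, h]

end TreeDiagram

/-- The contact contribution of `O` to `ψ̃_N`: all contractions with the external lines. -/
def contactPsi {N : ℕ} (H : ℝ) (O : LocalOperator N) (k : Fin N → Vec3) : ℂ :=
  ∑ σ : Equiv.Perm (Fin N), (TreeDiagram.contact O σ).psi H k

/-! ### Correlators -/

/-- `Re' ψ = (ψ + ψ^*|_{k → -k}) / 2`. -/
def rePrime {N : ℕ} (ψ : (Fin N → Vec3) → ℂ) (k : Fin N → Vec3) : ℂ :=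
  (1 / 2) * (ψ k + (starRingEnd ℂ) (ψ (-k)))

/-- The late-time power spectrum `1 / (2 Re' ψ̃_2) = H² / (2 k³)`. -/
def powerSpectrum (H : ℝ) (k : Vec3) : ℝ := H ^ 2 / (2 * ‖k‖ ^ 3)

/-- The correlator `⟨φ^N⟩'` generated by the coefficient `ψ̃_N` of the wavefunction,
`-2 Re' ψ̃_N / ∏ (2 Re' ψ̃_2)`; for `N = 4` this is the trispectrum. -/
def correlator {N : ℕ} (H : ℝ) (ψ : (Fin N → Vec3) → ℂ) (k : Fin N → Vec3) : ℂ :=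
  -2 * rePrime ψ k * ((∏ i, powerSpectrum H (k i) : ℝ) : ℂ)

/-- The in-in (Schwinger-Keldysh) correlator `⟨φ^N⟩'` generated by a contact vertex `O`: the
time-ordered diagram (vertex `+i`, propagators `H²/(2k³) K`, contour `∫_{-∞(1-iε)}^0`) plus the
anti-time-ordered one (vertex `-i`, propagators `H²/(2k³) K^*`, contour `∫_{-∞(1+iε)}^0`).
The conjugate propagator is `K^*(k, τ) = (1 + ikτ) e^{-ikτ} = bulkToBoundary (-k) τ`. -/
def inInContact {N : ℕ} (H : ℝ) (O : LocalOperator N) (k : Fin N → Vec3) (ε : ℝ) : ℂ :=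
  ((∏ i, powerSpectrum H (k i) : ℝ) : ℂ) * ∑ σ : Equiv.Perm (Fin N),
    O.coupling * O.spatial (fun i => k (σ i)) *
      (Complex.I * rayIntegral (contour ε) (fun τ => scaleFactor H τ ^ O.scalePower *
          ∏ i, iteratedDeriv (O.timeDeriv i) (bulkToBoundary ‖k (σ i)‖) τ) +
        -Complex.I * rayIntegral (contour (-ε)) (fun τ => scaleFactor H τ ^ O.scalePower *
          ∏ i, iteratedDeriv (O.timeDeriv i) (bulkToBoundary (-‖k (σ i)‖)) τ))

/-! ### The wavefunction of the universe -/

/-- The Fourier mode `φ_k = ∫ e^{-ik·x} φ(x) d³x` of a real boundary field. -/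
def mode (φ : 𝓢(Vec3, ℝ)) (k : Vec3) : ℂ :=
  ∫ x : Vec3, Complex.exp (-Complex.I * (inner ℝ k x : ℝ)) * (φ x : ℂ)

/-- Momenta `k_0, …, k_M` with `k_1, …, k_M` given and `∑ k = 0`. -/
def conserve {M : ℕ} (q : Fin M → Vec3) : Fin (M + 1) → Vec3 :=
  Fin.cons (-∑ i, q i) q

/-- The integrand of `∫ ψ_N φ^N`, `N = M + 1`, in momentum space. -/
def phaseIntegrand {M : ℕ} (ψ : (Fin (M + 1) → Vec3) → ℂ) (φ : 𝓢(Vec3, ℝ)) (q : Fin M → Vec3) :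
    ℂ :=
  ((((2 * Real.pi) ^ 3) ^ M : ℝ) : ℂ)⁻¹ * (ψ (conserve q) * ∏ i, mode φ (conserve q i))

/-- The factor `exp(-(1/N!) ∫ ψ_N φ^N)`, `N = M + 1`, of the wavefunction, with the momentum
integral restricted to the region `R`. -/
def wavefunctionFactor {M : ℕ} (ψ : (Fin (M + 1) → Vec3) → ℂ) (R : Set (Fin M → Vec3))
    (φ : 𝓢(Vec3, ℝ)) : ℂ :=
  Complex.exp (-(1 / (Nat.factorial (M + 1) : ℂ)) * ∫ q in R, phaseIntegrand ψ φ q)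

/-- `⟨A⟩ = ∫ 𝒟φ |Ψ|² A / ∫ 𝒟φ |Ψ|²`, with the measure `𝒟φ` realized as a measure `μ` on a space
`Ω` that parametrizes boundary fields. -/
def expectation {Ω : Type*} [MeasurableSpace Ω] (μ : Measure Ω) (Ψ : Ω → ℂ) (A : Ω → ℂ) : ℂ :=
  (∫ w, ((‖Ψ w‖ ^ 2 : ℝ) : ℂ) * A w ∂μ) / ((∫ w, ‖Ψ w‖ ^ 2 ∂μ : ℝ) : ℂ)

/-- The coefficient `ψ` is a pure phase of the wavefunction on the momentum region `R`, and it
drops out of all expectation values, whatever the rest `Ψ₀` of the wavefunction. -/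
def IsPurePhase.{u} {M : ℕ} (ψ : (Fin (M + 1) → Vec3) → ℂ) (R : Set (Fin M → Vec3)) : Prop :=
  (∀ φ : 𝓢(Vec3, ℝ), ‖wavefunctionFactor ψ R φ‖ = 1) ∧
  ∀ (Ω : Type u) [MeasurableSpace Ω] (μ : Measure Ω) (φ : Ω → 𝓢(Vec3, ℝ)) (Ψ₀ A : Ω → ℂ),
    expectation μ (fun w => Ψ₀ w * wavefunctionFactor ψ R (φ w)) A = expectation μ Ψ₀ A

end

end DeSitter

namespace DeSitter

open MeasureTheory Filter Topology
open scoped SchwartzMap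

noncomputable section

/-! ### Holomorphic integrals over rays -/

/-! The mechanism is a Wick rotation to `τ = ix`, `x > 0`. There `K = (1 + kx) e^{-kx}` and `G` are
real, `a = i/(Hx)`, every spatial derivative gives a factor `i` and every time derivative a factor
`1/i`. Dilation invariance makes the number of spatial derivatives plus `n` plus the power of `a`
equal to 4, for both parities, so the operator at a vertex is real up to sign. What is left is the
`i` of the vertex and the `i` of `dτ`, whose product is real. Hence every tree diagram is real,
whatever its parity (`isPhase_propagate`, `Branch.isPhase_field`,
`TreeDiagram.isPhase_regulated_I`). Each Levi-Civita determinant changes sign under `k → -k` while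
energies depend only on norms, so an odd number of P-odd vertices makes the diagram odd
(`Branch.field_neg`). Real and odd means `Re' ψ = 0`. As `φ_{-k}` is the conjugate of `φ_k`, the
exponent `∫ ψ φ^N` is then imaginary (`isPurePhase_of_real_odd`).

The rotation is justified in `rayIntegral_eq`: a ray integral is holomorphic in its direction and
invariant under positive rescaling of it, so its derivative vanishes. This needs local domination of
the integrand.

Without positive powers of `a` the domination is proved by induction over the tree. The class `Tame
ExpDecays` (all derivatives decay exponentially in sectors, with bounds uniform down to `τ = 0`) is
preserved by vertices and by `propagate`. For the latter, the time-ordered part of `G` becomes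
convolutions with `e^{ik|τ-τ'|}`, which solve first-order equations, and this controls all
derivatives; Cauchy estimates would lose powers of `1/|τ|` at the boundary.

For contact diagrams a scaling estimate bounds `ψ` by the cube of the total energy, which Schwartz
modes integrate. -/

/-- The open upper half-plane: the directions of contours along which `e^{ikτ}` decays. -/
def upperHalf : Set ℂ := {z | 0 < z.im}

theorem isOpen_upperHalf : IsOpen upperHalf :=
  isOpen_lt continuous_const Complex.continuous_im

theorem upperHalf_mem_nhds {τ : ℂ} (h : τ ∈ upperHalf) : upperHalf ∈ 𝓝 τ :=
  isOpen_upperHalf.mem_nhds h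

theorem isPreconnected_upperHalf : IsPreconnected upperHalf :=
  (convex_halfSpace_im_gt 0).isPreconnected

theorem ne_zero_of_mem_upperHalf {τ : ℂ} (h : τ ∈ upperHalf) : τ ≠ 0 := by
  rintro rfl
  simp [upperHalf] at h

theorem ofReal_mul_mem_upperHalf {s : ℝ} (hs : 0 < s) {τ : ℂ} (h : τ ∈ upperHalf) :
    (s : ℂ) * τ ∈ upperHalf := by
  have h' : 0 < τ.im := h
  change 0 < ((s : ℂ) * τ).im
  rw [Complex.im_ofReal_mul]
  positivity

theorem mul_I_mem_upperHalf {x : ℝ} (hx : 0 < x) : (x : ℂ) * Complex.I ∈ upperHalf :=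
  ofReal_mul_mem_upperHalf hx (by simp [upperHalf])

theorem contour_mem_upperHalf {ε : ℝ} (hε : 0 < ε) : contour ε ∈ upperHalf := by
  simpa [upperHalf, contour] using hε

theorem differentiableOn_iteratedDeriv {f : ℂ → ℂ} (hf : DifferentiableOn ℂ f upperHalf)
    (n : ℕ) : DifferentiableOn ℂ (iteratedDeriv n f) upperHalf := by
  have := ((Complex.analyticOnNhd_iff_differentiableOn isOpen_upperHalf).2 hf).iterated_deriv n
  rw [iteratedDeriv_eq_iterate]
  exact this.differentiableOn

theorem contDiffAt_of_differentiableOn_upperHalf {f : ℂ → ℂ} (hf : DifferentiableOn ℂ f upperHalf)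
    {τ : ℂ} (hτ : τ ∈ upperHalf) (n : WithTop ℕ∞) : ContDiffAt ℂ n f τ :=
  ((Complex.analyticOnNhd_iff_differentiableOn isOpen_upperHalf).2 hf τ hτ).contDiffAt

/-- A parametric integral of holomorphic functions is holomorphic if it is dominated locally
uniformly. -/
theorem differentiableOn_integral_of_dominated {F : ℂ → ℝ → ℂ} {U : Set ℂ} {S : Set ℝ}
    (hU : IsOpen U) (hS : MeasurableSet S)
    (hmeas : ∀ τ ∈ U, AEStronglyMeasurable (F τ) (volume.restrict S))
    (hdiff : ∀ s ∈ S, DifferentiableOn ℂ (fun τ => F τ s) U)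
    (hdom : ∀ τ₀ ∈ U, ∃ g : ℝ → ℝ, IntegrableOn g S ∧
      ∀ᶠ τ in 𝓝 τ₀, ∀ s ∈ S, ‖F τ s‖ ≤ g s) :
    DifferentiableOn ℂ (fun τ => ∫ s in S, F τ s) U := by
  intro τ₀ hτ₀
  obtain ⟨g, hg, hb⟩ := hdom τ₀ hτ₀
  obtain ⟨r, hr, hball⟩ := Metric.mem_nhds_iff.1 (inter_mem (hU.mem_nhds hτ₀) hb)
  have hr2 : 0 < r / 2 := by positivity
  have hderiv : ∀ s ∈ S, ∀ τ ∈ Metric.ball τ₀ (r / 2),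
      HasDerivAt (fun τ => F τ s) (deriv (fun τ => F τ s) τ) τ := by
    intro s hs τ hτ
    refine ((hdiff s hs).differentiableAt (hU.mem_nhds (hball ?_).1)).hasDerivAt
    exact Metric.ball_subset_ball (by linarith) hτ
  -- Cauchy's estimate on circles of radius `r / 2`, which stay inside the ball of radius `r`.
  have hbound : ∀ s ∈ S, ∀ τ ∈ Metric.ball τ₀ (r / 2),
      ‖deriv (fun τ => F τ s) τ‖ ≤ g s / (r / 2) := by
    intro s hs τ hτ
    have hsub : Metric.closedBall τ (r / 2) ⊆ Metric.ball τ₀ r := by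
      apply Metric.closedBall_subset_ball'
      rw [Metric.mem_ball] at hτ
      linarith
    refine Complex.norm_deriv_le_of_forall_mem_sphere_norm_le hr2 ?_ ?_
    · refine DifferentiableOn.diffContOnCl ?_
      rw [closure_ball _ hr2.ne']
      exact (hdiff s hs).mono fun z hz => (hball (hsub hz)).1
    · exact fun z hz => (hball (hsub (Metric.sphere_subset_closedBall hz))).2 s hs
  have hτ₀b : τ₀ ∈ Metric.ball τ₀ (r / 2) := Metric.mem_ball_self hr2
  -- The derivative is measurable in `s` as the limit of difference quotients along the steps
  -- `(r/2)/(n+2)`, which keep the shifted point in the ball.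
  have hmeas' : AEStronglyMeasurable (fun s => deriv (fun τ => F τ s) τ₀)
      (volume.restrict S) := by
    have hu : Tendsto (fun n : ℕ => ((r / 2 / ((n : ℝ) + 2) : ℝ) : ℂ)) atTop (𝓝[≠] 0) := by
      refine tendsto_nhdsWithin_iff.2 ⟨?_, ?_⟩
      · rw [← Complex.ofReal_zero]
        refine (Complex.continuous_ofReal.tendsto 0).comp ?_
        exact tendsto_const_nhds.div_atTop
          (tendsto_natCast_atTop_atTop.atTop_add tendsto_const_nhds)
      · refine Eventually.of_forall fun n => ?_
        have : (0 : ℝ) < r / 2 / ((n : ℝ) + 2) := by positivity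
        exact Complex.ofReal_ne_zero.2 this.ne'
    refine aestronglyMeasurable_of_tendsto_ae (u := atTop)
      (f := fun (n : ℕ) s => ((r / 2 / ((n : ℝ) + 2) : ℝ) : ℂ)⁻¹ •
        (F (τ₀ + ((r / 2 / ((n : ℝ) + 2) : ℝ) : ℂ)) s - F τ₀ s)) (fun n => ?_) ?_
    · have hn : τ₀ + ((r / 2 / ((n : ℝ) + 2) : ℝ) : ℂ) ∈ U := by
        refine (hball ?_).1
        have h2 : (0 : ℝ) < (n : ℝ) + 2 := by positivity
        rw [Metric.mem_ball, dist_eq_norm, add_sub_cancel_left, Complex.norm_real,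
          Real.norm_of_nonneg (by positivity), div_lt_iff₀ h2]
        nlinarith [n.cast_nonneg (α := ℝ)]
      exact ((hmeas _ hn).sub (hmeas _ hτ₀)).const_smul
        (((r / 2 / ((n : ℝ) + 2) : ℝ) : ℂ)⁻¹)
    · refine (ae_restrict_iff' hS).2 (Eventually.of_forall fun s hs => ?_)
      exact (hasDerivAt_iff_tendsto_slope_zero.1 (hderiv s hs τ₀ hτ₀b)).comp hu
  refine ((hasDerivAt_integral_of_dominated_loc_of_deriv_le
    (F' := fun τ s => deriv (fun τ => F τ s) τ) (bound := fun s => g s / (r / 2))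
    (Metric.ball_mem_nhds τ₀ hr2) ?_ ?_ hmeas' ?_ (hg.div_const _) ?_).2).differentiableAt
      |>.differentiableWithinAt
  · filter_upwards [hU.mem_nhds hτ₀] with τ hτ using hmeas τ hτ
  · refine Integrable.mono' hg (hmeas τ₀ hτ₀) ?_
    exact (ae_restrict_iff' hS).2 (Eventually.of_forall (hball (Metric.mem_ball_self hr)).2)
  · exact (ae_restrict_iff' hS).2 (Eventually.of_forall hbound)
  · exact (ae_restrict_iff' hS).2 (Eventually.of_forall hderiv)

/-- The restriction of a holomorphic function to a ray is measurable. -/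
theorem aestronglyMeasurable_ray {f : ℂ → ℂ} (hf : DifferentiableOn ℂ f upperHalf) {τ : ℂ}
    (hτ : τ ∈ upperHalf) :
    AEStronglyMeasurable (fun s : ℝ => f ((s : ℂ) * τ)) (volume.restrict (Set.Ioi 0)) := by
  refine ContinuousOn.aestronglyMeasurable ?_ measurableSet_Ioi
  refine hf.continuousOn.comp (by fun_prop) fun s hs => ofReal_mul_mem_upperHalf hs hτ

theorem differentiableOn_ray {f : ℂ → ℂ} (hf : DifferentiableOn ℂ f upperHalf) {s : ℝ}
    (hs : 0 < s) : DifferentiableOn ℂ (fun τ => f ((s : ℂ) * τ)) upperHalf :=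
  hf.comp (by fun_prop) fun _ hτ => ofReal_mul_mem_upperHalf hs hτ

/-- `f` is integrable along rays, locally uniformly in their direction. -/
def RayDominated (f : ℂ → ℂ) : Prop :=
  ∀ ω₀ : ℂ, 0 < ω₀.im → ∃ g : ℝ → ℝ, IntegrableOn g (Set.Ioi 0) ∧
    ∀ᶠ ω in 𝓝 ω₀, ∀ s : ℝ, 0 < s → ‖f ((s : ℂ) * ω)‖ ≤ g s

theorem eventually_norm_mul_le {F : ℂ → ℝ → ℂ} {τ₀ : ℂ} {S : Set ℝ} {g : ℝ → ℝ}
    (h : ∀ᶠ τ in 𝓝 τ₀, ∀ s ∈ S, ‖F τ s‖ ≤ g s) :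
    ∀ᶠ τ in 𝓝 τ₀, ∀ s ∈ S, ‖τ * F τ s‖ ≤ (‖τ₀‖ + 1) * g s := by
  have h1 : ∀ᶠ τ : ℂ in 𝓝 τ₀, ‖τ‖ < ‖τ₀‖ + 1 :=
    continuous_norm.continuousAt.eventually_lt continuousAt_const (by simp)
  filter_upwards [h, h1] with τ hτ h1 s hs
  rw [norm_mul]
  exact mul_le_mul h1.le (hτ s hs) (norm_nonneg _) (by positivity)

theorem differentiableOn_rayIntegral {f : ℂ → ℂ} (hf : DifferentiableOn ℂ f upperHalf)
    (hd : RayDominated f) : DifferentiableOn ℂ (fun ω => rayIntegral ω f) upperHalf := by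
  unfold rayIntegral
  refine (differentiableOn_integral_of_dominated isOpen_upperHalf measurableSet_Ioi
    (fun τ hτ => (aestronglyMeasurable_ray hf hτ).const_mul _)
    (fun s hs => differentiableOn_id.mul (differentiableOn_ray hf hs)) ?_).neg
  intro τ₀ hτ₀
  obtain ⟨g, hg, hb⟩ := hd τ₀ hτ₀
  exact ⟨fun s => (‖τ₀‖ + 1) * g s, hg.const_mul _, eventually_norm_mul_le hb⟩

theorem rayIntegral_ofReal_mul (f : ℂ → ℂ) (ω : ℂ) {t : ℝ} (ht : 0 < t) :
    rayIntegral ((t : ℂ) * ω) f = rayIntegral ω f := by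
  have h := integral_comp_mul_left_Ioi (fun s : ℝ => ω * f ((s : ℂ) * ω)) 0 ht
  rw [mul_zero, eq_inv_smul_iff₀ ht.ne', ← integral_smul] at h
  rw [rayIntegral, rayIntegral, ← h]
  congr 1
  refine integral_congr_ae (Eventually.of_forall fun s => ?_)
  simp only [Complex.real_smul, Complex.ofReal_mul]
  ring_nf

/-- The integral over a ray does not depend on its direction (rotation of the contour). -/
theorem rayIntegral_eq {f : ℂ → ℂ} (hf : DifferentiableOn ℂ f upperHalf) (hd : RayDominated f)
    {ω ω' : ℂ} (hω : ω ∈ upperHalf) (hω' : ω' ∈ upperHalf) :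
    rayIntegral ω f = rayIntegral ω' f := by
  have hF := differentiableOn_rayIntegral hf hd
  refine isOpen_upperHalf.is_const_of_deriv_eq_zero isPreconnected_upperHalf hF ?_ hω hω'
  intro τ hτ
  have h1 : HasDerivAt (fun ω => rayIntegral ω f) (deriv (fun ω => rayIntegral ω f) τ)
      (((1 : ℝ) : ℂ) * τ) := by
    simpa using (hF.differentiableAt (upperHalf_mem_nhds hτ)).hasDerivAt
  have h2 : HasDerivAt (fun t : ℝ => (t : ℂ) * τ) (1 * τ) 1 :=
    (Complex.ofRealCLM.hasDerivAt (x := 1)).mul_const τ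
  have h3 := h1.comp (1 : ℝ) h2
  -- Along the radial direction the function is constant; by holomorphy this one direction
  -- determines the complex derivative.
  have h4 : HasDerivAt (fun t : ℝ => rayIntegral ((t : ℂ) * τ) f) 0 1 := by
    refine (hasDerivAt_const (1 : ℝ) (rayIntegral τ f)).congr_of_eventuallyEq ?_
    filter_upwards [lt_mem_nhds one_pos] with t ht using rayIntegral_ofReal_mul f τ ht
  have h5 := h3.unique h4
  simpa [ne_zero_of_mem_upperHalf hτ] using h5

/-! ### Propagators -/

theorem iteratedDeriv_bulkToBoundary (k : ℝ) (n : ℕ) :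
    iteratedDeriv n (bulkToBoundary k) = fun z =>
      (Complex.I * k) ^ n * (1 - n - Complex.I * k * z) * Complex.exp (Complex.I * k * z) := by
  induction n with
  | zero => funext z; simp [bulkToBoundary]
  | succ n ih =>
    rw [iteratedDeriv_succ, ih]
    funext z
    have h1 : HasDerivAt (fun z : ℂ => Complex.I * k * z) (Complex.I * k) z := by
      simpa using (hasDerivAt_id z).const_mul (Complex.I * (k : ℂ))
    have h2 := (((h1.const_sub (1 - n : ℂ)).const_mul ((Complex.I * k) ^ n))).mul h1.cexp
    refine h2.deriv.trans ?_
    push_cast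
    ring

theorem continuous_iteratedDeriv_bulkToBoundary (k : ℝ) (n : ℕ) :
    Continuous (iteratedDeriv n (bulkToBoundary k)) := by
  rw [iteratedDeriv_bulkToBoundary]; fun_prop

theorem differentiable_iteratedDeriv_bulkToBoundary (k : ℝ) (n : ℕ) :
    Differentiable ℂ (iteratedDeriv n (bulkToBoundary k)) := by
  rw [iteratedDeriv_bulkToBoundary]; fun_prop

theorem differentiable_bulkToBoundary (k : ℝ) : Differentiable ℂ (bulkToBoundary k) := by
  simpa using differentiable_iteratedDeriv_bulkToBoundary k 0

/-- Both terms of `G` contain `K(k, τ₂)`, and `bulkToBoundary (-k)` plays the role of `K^*`.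
Everything about `G` thereby reduces to the boundary propagator. -/
theorem bulkToBulk_eq (H k : ℝ) (τ₁ τ₂ : ℂ) :
    bulkToBulk H k τ₁ τ₂ = (H : ℂ) ^ 2 / (2 * (k : ℂ) ^ 3) *
      ((bulkToBoundary (-k) τ₁ - bulkToBoundary k τ₁) * bulkToBoundary k τ₂) := by
  have h1 : -Complex.I * k * (τ₁ - τ₂) = Complex.I * (-k : ℝ) * τ₁ + Complex.I * k * τ₂ := by
    push_cast; ring
  have h2 : Complex.I * k * (τ₁ + τ₂) = Complex.I * k * τ₁ + Complex.I * k * τ₂ := by ring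
  rw [bulkToBulk, h1, h2, Complex.exp_add, Complex.exp_add, bulkToBoundary, bulkToBoundary,
    bulkToBoundary]
  push_cast
  ring

theorem iteratedDeriv_bulkToBulk_right (H k : ℝ) (b : ℕ) (τ z : ℂ) :
    iteratedDeriv b (fun τ' => bulkToBulk H k τ τ') z = (H : ℂ) ^ 2 / (2 * (k : ℂ) ^ 3) *
      ((bulkToBoundary (-k) τ - bulkToBoundary k τ) * iteratedDeriv b (bulkToBoundary k) z) := by
  simp_rw [bulkToBulk_eq]
  rw [iteratedDeriv_const_mul_field, iteratedDeriv_const_mul_field]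

theorem iteratedDeriv_bulkToBulk_left (H k : ℝ) (b : ℕ) (τ z : ℂ) :
    iteratedDeriv b (fun τ' => bulkToBulk H k τ' τ) z = (H : ℂ) ^ 2 / (2 * (k : ℂ) ^ 3) *
      ((iteratedDeriv b (bulkToBoundary (-k)) z - iteratedDeriv b (bulkToBoundary k) z) *
        bulkToBoundary k τ) := by
  simp_rw [bulkToBulk_eq]
  rw [iteratedDeriv_const_mul_field, iteratedDeriv_mul_const_field, iteratedDeriv_fun_sub
    (differentiable_bulkToBoundary _).contDiff.contDiffAt
    (differentiable_bulkToBoundary _).contDiff.contDiffAt]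

theorem bulkDeriv_of_one_lt (H k : ℝ) (b : ℕ) (τ : ℂ) {s : ℝ} (hs : 1 < s) :
    bulkDeriv H k b τ s = (H : ℂ) ^ 2 / (2 * (k : ℂ) ^ 3) *
      ((bulkToBoundary (-k) τ - bulkToBoundary k τ) *
        iteratedDeriv b (bulkToBoundary k) (s * τ)) := by
  rw [bulkDeriv, if_pos hs, iteratedDeriv_bulkToBulk_right]

theorem bulkDeriv_of_le_one (H k : ℝ) (b : ℕ) (τ : ℂ) {s : ℝ} (hs : s ≤ 1) :
    bulkDeriv H k b τ s = (H : ℂ) ^ 2 / (2 * (k : ℂ) ^ 3) *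
      ((iteratedDeriv b (bulkToBoundary (-k)) (s * τ) -
        iteratedDeriv b (bulkToBoundary k) (s * τ)) * bulkToBoundary k τ) := by
  rw [bulkDeriv, if_neg hs.not_gt, iteratedDeriv_bulkToBulk_left]

theorem differentiable_bulkDeriv (H k : ℝ) (b : ℕ) (s : ℝ) :
    Differentiable ℂ (fun τ => bulkDeriv H k b τ s) := by
  have h := fun k => differentiable_bulkToBoundary k
  have h' := fun k => (differentiable_iteratedDeriv_bulkToBoundary k b).comp
    (differentiable_id.const_mul (s : ℂ))
  rcases lt_or_ge 1 s with hs | hs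
  · simp_rw [bulkDeriv_of_one_lt H k b _ hs]
    exact (((h _).sub (h _)).mul (h' k)).const_mul _
  · simp_rw [bulkDeriv_of_le_one H k b _ hs]
    exact (((h' _).sub (h' _)).mul (h k)).const_mul _

theorem measurable_bulkDeriv (H k : ℝ) (b : ℕ) (τ : ℂ) : Measurable (bulkDeriv H k b τ) := by
  have h' := fun k => (continuous_iteratedDeriv_bulkToBoundary k b).comp
    (Complex.continuous_ofReal.mul (continuous_const (y := τ)))
  refine Measurable.ite (measurableSet_lt measurable_const measurable_id) ?_ ?_
  · simp_rw [iteratedDeriv_bulkToBulk_right]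
    exact (((h' k).const_mul _).const_mul _).measurable
  · simp_rw [iteratedDeriv_bulkToBulk_left]
    exact ((((h' _).sub (h' _)).mul_const _).const_mul _).measurable

theorem bulkJump_eq (H k : ℝ) (j : ℕ) (τ : ℂ) :
    bulkJump H k j τ = (H : ℂ) ^ 2 / (2 * (k : ℂ) ^ 3) *
      (iteratedDeriv j (bulkToBoundary (-k)) τ * bulkToBoundary k τ -
        bulkToBoundary (-k) τ * iteratedDeriv j (bulkToBoundary k) τ) := by
  rw [bulkJump, iteratedDeriv_bulkToBulk_left, iteratedDeriv_bulkToBulk_right]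
  ring

theorem differentiable_bulkJump (H k : ℝ) (j : ℕ) : Differentiable ℂ (bulkJump H k j) := by
  have h := fun k => differentiable_bulkToBoundary k
  have h' := fun k => differentiable_iteratedDeriv_bulkToBoundary k j
  rw [funext (bulkJump_eq H k j)]
  exact (((h' _).mul (h _)).sub ((h _).mul (h' _))).const_mul _

theorem differentiableOn_vertexFactor {N : ℕ} (H : ℝ) (O : LocalOperator N) (p : Fin N → Vec3)
    (hH : 0 < H) : DifferentiableOn ℂ (vertexFactor H O p) upperHalf := by
  intro τ hτ
  have hτ := ne_zero_of_mem_upperHalf hτ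
  have hH' : (H : ℂ) ≠ 0 := by exact_mod_cast hH.ne'
  refine DifferentiableAt.differentiableWithinAt ?_
  refine DifferentiableAt.const_mul (DifferentiableAt.zpow ?_ (Or.inl ?_)) _
  · exact (differentiableAt_const _).div (differentiableAt_id.const_mul _) (mul_ne_zero hH' hτ)
  · exact div_ne_zero (neg_ne_zero.2 one_ne_zero) (mul_ne_zero hH' hτ)

/-- The propagator integral is dominated, locally uniformly in the time at the root end. -/
def PropagateDominated (H k : ℝ) (b : ℕ) (S : ℂ → ℂ) : Prop :=
  ∀ τ₀ : ℂ, 0 < τ₀.im → ∃ g : ℝ → ℝ, IntegrableOn g (Set.Ioi 0) ∧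
    ∀ᶠ τ in 𝓝 τ₀, ∀ s : ℝ, 0 < s → ‖bulkDeriv H k b τ s * S ((s : ℂ) * τ)‖ ≤ g s

/-- The step functions depend on the ratio `s = τ'/τ` alone, so for each fixed `s` the integrand is
holomorphic in `τ`. -/
theorem differentiableOn_propagate {H k : ℝ} {b : ℕ} {S : ℂ → ℂ}
    (hS : DifferentiableOn ℂ S upperHalf) (hd : PropagateDominated H k b S) :
    DifferentiableOn ℂ (propagate H k b S) upperHalf := by
  unfold propagate
  refine DifferentiableOn.add ?_ ?_
  · refine (differentiableOn_integral_of_dominated isOpen_upperHalf measurableSet_Ioi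
      (fun τ hτ => AEStronglyMeasurable.const_mul (AEStronglyMeasurable.mul
        (measurable_bulkDeriv H k b τ).aestronglyMeasurable (aestronglyMeasurable_ray hS hτ)) _)
      (fun s hs => differentiableOn_id.mul ((differentiable_bulkDeriv H k b s).differentiableOn.mul
        (differentiableOn_ray hS hs))) ?_).neg
    intro τ₀ hτ₀
    obtain ⟨g, hg, hb⟩ := hd τ₀ hτ₀
    exact ⟨fun s => (‖τ₀‖ + 1) * g s, hg.const_mul _, eventually_norm_mul_le hb⟩
  · refine DifferentiableOn.fun_sum fun j _ => ?_
    exact ((differentiable_bulkJump H k j).differentiableOn.const_mul _).mul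
      (differentiableOn_iteratedDeriv hS _)

/-! ### Phases on the imaginary axis -/

/-- `z` is a real multiple of `i ^ p`. -/
def IsPhase (p : ℤ) (z : ℂ) : Prop := ∃ r : ℝ, z = Complex.I ^ p * r

namespace IsPhase

variable {p q : ℤ} {z w : ℂ}

theorem iff_im : IsPhase p z ↔ (Complex.I ^ (-p) * z).im = 0 := by
  constructor
  · rintro ⟨r, rfl⟩
    rw [← mul_assoc, ← zpow_add₀ Complex.I_ne_zero]
    simp
  · intro h
    refine ⟨(Complex.I ^ (-p) * z).re, ?_⟩
    have h' : ((Complex.I ^ (-p) * z).re : ℂ) = Complex.I ^ (-p) * z :=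
      Complex.ext rfl (by simpa using h.symm)
    rw [h', ← mul_assoc, ← zpow_add₀ Complex.I_ne_zero]
    simp

theorem im_eq_zero (h : IsPhase 0 z) : z.im = 0 := by simpa using iff_im.1 h

theorem ofReal (r : ℝ) : IsPhase 0 r := ⟨r, by simp⟩

theorem one : IsPhase 0 1 := by simpa using ofReal 1

theorem I : IsPhase 1 Complex.I := ⟨1, by simp⟩

theorem mul (hz : IsPhase p z) (hw : IsPhase q w) : IsPhase (p + q) (z * w) := by
  obtain ⟨r, rfl⟩ := hz
  obtain ⟨t, rfl⟩ := hw
  exact ⟨r * t, by rw [zpow_add₀ Complex.I_ne_zero]; push_cast; ring⟩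

theorem add (hz : IsPhase p z) (hw : IsPhase p w) : IsPhase p (z + w) := by
  obtain ⟨r, rfl⟩ := hz
  obtain ⟨t, rfl⟩ := hw
  exact ⟨r + t, by push_cast; ring⟩

theorem neg (hz : IsPhase p z) : IsPhase p (-z) := by
  obtain ⟨r, rfl⟩ := hz
  exact ⟨-r, by push_cast; ring⟩

theorem sub (hz : IsPhase p z) (hw : IsPhase p w) : IsPhase p (z - w) :=
  sub_eq_add_neg z w ▸ hz.add hw.neg

theorem zpow (hz : IsPhase p z) (n : ℤ) : IsPhase (p * n) (z ^ n) := by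
  obtain ⟨r, rfl⟩ := hz
  exact ⟨r ^ n, by rw [mul_zpow, ← zpow_mul]; push_cast; ring⟩

theorem pow (hz : IsPhase p z) (n : ℕ) : IsPhase (p * n) (z ^ n) := by
  simpa using hz.zpow n

theorem sum {ι : Type*} {s : Finset ι} {f : ι → ℂ} (h : ∀ i ∈ s, IsPhase p (f i)) :
    IsPhase p (∑ i ∈ s, f i) :=
  Finset.sum_induction f (IsPhase p) (fun _ _ => add) ⟨0, by simp⟩ h

theorem prod {ι : Type*} {s : Finset ι} {f : ι → ℂ} {e : ι → ℤ}
    (h : ∀ i ∈ s, IsPhase (e i) (f i)) : IsPhase (∑ i ∈ s, e i) (∏ i ∈ s, f i) := by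
  classical
  induction s using Finset.induction_on with
  | empty => simpa using one
  | insert a s ha ih =>
    rw [Finset.sum_insert ha, Finset.prod_insert ha]
    exact (h a (by simp)).mul (ih fun i hi => h i (by simp [hi]))

/-- Only the parity of the exponent matters, since `i² = -1` is real. -/
theorem congr (hz : IsPhase p z) (h : Even (q - p)) : IsPhase q z := by
  obtain ⟨r, rfl⟩ := hz
  obtain ⟨c, hc⟩ := h
  refine ⟨(-1) ^ (-c) * r, ?_⟩
  have : Complex.I ^ p = Complex.I ^ q * (-1) ^ (-c) := by
    rw [← Complex.I_sq, ← zpow_natCast, ← zpow_mul, ← zpow_add₀ Complex.I_ne_zero]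
    congr 1
    push_cast
    omega
  rw [this]
  push_cast
  ring

/-- Integrability is not needed: a divergent integral has the value `0`, which has every phase. -/
theorem integral {S : Set ℝ} {f : ℝ → ℂ} (hS : MeasurableSet S) (h : ∀ s ∈ S, IsPhase p (f s)) :
    IsPhase p (∫ s in S, f s) := by
  rw [iff_im, ← integral_const_mul]
  have : ∫ s in S, Complex.I ^ (-p) * f s = ∫ s in S, ((Complex.I ^ (-p) * f s).re : ℂ) := by
    refine setIntegral_congr_fun hS fun s hs => ?_
    exact Complex.ext rfl (by simpa using iff_im.1 (h s hs))
  rw [this]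
  exact (congrArg Complex.im integral_ofReal).trans (Complex.ofReal_im _)

/-- Since `d/dx f(ix) = i f'(ix)`, one complex derivative costs one factor `i`. -/
theorem deriv {f : ℂ → ℂ} (hf : DifferentiableOn ℂ f upperHalf)
    (h : ∀ x : ℝ, 0 < x → IsPhase p (f (x * Complex.I))) {x : ℝ} (hx : 0 < x) :
    IsPhase (p - 1) (_root_.deriv f (x * Complex.I)) := by
  have h1 := (hf.differentiableAt (upperHalf_mem_nhds (mul_I_mem_upperHalf hx))).hasDerivAt
  have h2 : HasDerivAt (fun t : ℝ => (t : ℂ) * Complex.I) (1 * Complex.I) x :=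
    (Complex.ofRealCLM.hasDerivAt (x := x)).mul_const Complex.I
  have h3 := (h1.comp x h2).const_mul (Complex.I ^ (-p))
  have h4 := Complex.imCLM.hasFDerivAt.comp_hasDerivAt x h3
  have h5 : HasDerivAt (fun t : ℝ => (Complex.I ^ (-p) * f ((t : ℂ) * Complex.I)).im) 0 x := by
    refine (hasDerivAt_const x (0 : ℝ)).congr_of_eventuallyEq ?_
    filter_upwards [lt_mem_nhds hx] with t ht using iff_im.1 (h t ht)
  have h6 := h4.unique h5
  rw [iff_im, neg_sub, sub_eq_neg_add, zpow_add₀ Complex.I_ne_zero, zpow_one]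
  rw [← h6, Complex.imCLM_apply]
  congr 1
  ring

theorem iteratedDeriv {f : ℂ → ℂ} (hf : DifferentiableOn ℂ f upperHalf)
    (h : ∀ x : ℝ, 0 < x → IsPhase p (f (x * Complex.I))) (n : ℕ) {x : ℝ} (hx : 0 < x) :
    IsPhase (p - n) (_root_.iteratedDeriv n f (x * Complex.I)) := by
  induction n generalizing x with
  | zero => simpa using h x hx
  | succ n ih =>
    rw [iteratedDeriv_succ]
    have := deriv (differentiableOn_iteratedDeriv hf n) (fun _ => ih) hx
    rwa [show p - (n + 1 : ℕ) = p - n - 1 by push_cast; ring]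

end IsPhase

theorem isPhase_bulkToBoundary (k x : ℝ) : IsPhase 0 (bulkToBoundary k (x * Complex.I)) := by
  refine ⟨(1 + k * x) * Real.exp (-(k * x)), ?_⟩
  have : Complex.I * k * (x * Complex.I) = -(k * x) := by
    linear_combination (k * x : ℂ) * Complex.I_mul_I
  rw [bulkToBoundary, this]
  push_cast
  simp

theorem isPhase_iteratedDeriv_bulkToBoundary (k : ℝ) (n : ℕ) {x : ℝ} (hx : 0 < x) :
    IsPhase (-n) (iteratedDeriv n (bulkToBoundary k) (x * Complex.I)) := by
  simpa using IsPhase.iteratedDeriv (differentiable_bulkToBoundary k).differentiableOn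
    (fun x _ => isPhase_bulkToBoundary k x) n hx

theorem isPhase_bulkPrefactor (H k : ℝ) : IsPhase 0 ((H : ℂ) ^ 2 / (2 * (k : ℂ) ^ 3)) := by
  have h := IsPhase.ofReal (H ^ 2 / (2 * k ^ 3))
  push_cast at h
  exact h

theorem isPhase_bulkDeriv (H k : ℝ) (b : ℕ) {x s : ℝ} (hx : 0 < x) (hs : 0 < s) :
    IsPhase (-b) (bulkDeriv H k b (x * Complex.I) s) := by
  have hsx : (s : ℂ) * (x * Complex.I) = (s * x : ℝ) * Complex.I := by push_cast; ring
  have h := fun k => isPhase_iteratedDeriv_bulkToBoundary k b (mul_pos hs hx)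
  rcases lt_or_ge 1 s with hs1 | hs1
  · rw [bulkDeriv_of_one_lt H k b _ hs1, hsx]
    simpa using (isPhase_bulkPrefactor H k).mul
      (((isPhase_bulkToBoundary (-k) x).sub (isPhase_bulkToBoundary k x)).mul (h k))
  · rw [bulkDeriv_of_le_one H k b _ hs1, hsx]
    simpa using (isPhase_bulkPrefactor H k).mul
      (((h (-k)).sub (h k)).mul (isPhase_bulkToBoundary k x))

theorem isPhase_bulkJump (H k : ℝ) (j : ℕ) {x : ℝ} (hx : 0 < x) :
    IsPhase (-j) (bulkJump H k j (x * Complex.I)) := by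
  have h := fun k => isPhase_iteratedDeriv_bulkToBoundary k j hx
  have h' := fun k => isPhase_bulkToBoundary k x
  rw [bulkJump_eq]
  have h1 := (h (-k)).mul (h' k)
  have h2 := (h' (-k)).mul (h k)
  rw [add_zero] at h1
  rw [zero_add] at h2
  simpa using (isPhase_bulkPrefactor H k).mul (h1.sub h2)

/-- Count of exponents: `dτ'` gives `1`, `∂^b G` gives `-b`, the source `1 + b`, in total `2`. In
the contact terms the jump gives `-j` and the derivative of the source `(1 + b) - (b - 1 - j)`,
again `2`. -/
theorem isPhase_propagate {H k : ℝ} {b : ℕ} {S : ℂ → ℂ} (hS : DifferentiableOn ℂ S upperHalf)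
    (h : ∀ x : ℝ, 0 < x → IsPhase (1 + b) (S (x * Complex.I))) {x : ℝ} (hx : 0 < x) :
    IsPhase 0 (propagate H k b S (x * Complex.I)) := by
  refine IsPhase.add (IsPhase.neg ?_) (IsPhase.sum fun j hj => ?_)
  · refine IsPhase.integral measurableSet_Ioi fun s hs => ?_
    have hsx : (s : ℂ) * (x * Complex.I) = (s * x : ℝ) * Complex.I := by push_cast; ring
    rw [hsx]
    refine (((IsPhase.ofReal x).mul IsPhase.I).mul ((isPhase_bulkDeriv H k b hx hs).mul
      (h _ (mul_pos hs hx)))).congr ?_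
    exact ⟨-1, by ring⟩
  · have hj := Finset.mem_range.1 hj
    have h1 : IsPhase 0 ((-1 : ℂ) ^ (b - 1 - j)) := by
      simpa using IsPhase.ofReal ((-1) ^ (b - 1 - j))
    refine ((h1.mul (isPhase_bulkJump H k j hx)).mul
      (IsPhase.iteratedDeriv hS h (b - 1 - j) hx)).congr ?_
    exact ⟨-1, by omega⟩

/-- Spatial derivatives, time derivatives and the power of `a` add up to 4 in both parity classes,
so the number of spatial derivatives has the parity of `scalePower + n`. -/
theorem isPhase_spatial {N : ℕ} (O : LocalOperator N) (p : Fin N → Vec3) :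
    IsPhase (O.scalePower + O.n) (O.spatial p) := by
  have h2 : IsPhase (1 * (2 * O.m : ℕ) + 0) (Complex.I ^ (2 * O.m) *
      ((∏ l, inner ℝ (p (O.contr l).1) (p (O.contr l).2) : ℝ) : ℂ)) :=
    (IsPhase.I.pow _).mul (IsPhase.ofReal _)
  rcases he : O.eps with _ | t
  · simp only [LocalOperator.spatial, he]
    refine (IsPhase.one.mul h2).congr ?_
    simp only [LocalOperator.scalePower, he]
    exact ⟨2 - 2 * O.m, by push_cast; ring⟩
  · simp only [LocalOperator.spatial, he]
    refine (((IsPhase.I.pow 3).mul (IsPhase.ofReal _)).mul h2).congr ?_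
    simp only [LocalOperator.scalePower, he]
    exact ⟨-1 - 2 * O.m, by push_cast; ring⟩

theorem isPhase_scaleFactor (H x : ℝ) : IsPhase 1 (scaleFactor H (x * Complex.I)) := by
  refine ⟨(H * x)⁻¹, ?_⟩
  rw [scaleFactor, ← mul_assoc, div_eq_mul_inv, mul_inv, Complex.inv_I, zpow_one]
  push_cast
  ring

/-- The power of `a` enters once through the spatial derivatives and once through `a` itself, and
drops out modulo 2. -/
theorem isPhase_vertexFactor {N : ℕ} (H : ℝ) (O : LocalOperator N) (p : Fin N → Vec3) (x : ℝ) :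
    IsPhase (1 + O.n) (vertexFactor H O p (x * Complex.I)) := by
  refine (((IsPhase.I.mul (IsPhase.ofReal O.coupling)).mul (isPhase_spatial O p)).mul
    ((isPhase_scaleFactor H x).zpow O.scalePower)).congr ?_
  exact ⟨-O.scalePower, by ring⟩

/-! ### Branches and diagrams -/

namespace Branch

variable {E : ℕ}

/-- The vertex at the root end of a branch together with the branches that end there. -/
def source (H : ℝ) (k : Fin E → Vec3) {N : ℕ} (O : LocalOperator (N + 1))
    (legs : Fin N → Branch E) (τ : ℂ) : ℂ :=
  vertexFactor H O (Fin.cons (-∑ i, (legs i).momentum k) fun i => (legs i).momentum k) τ *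
    ∏ i, iteratedDeriv (O.timeDeriv i.succ) ((legs i).field H k) τ

theorem field_vertex (H : ℝ) (k : Fin E → Vec3) {N : ℕ} (O : LocalOperator (N + 1))
    (legs : Fin N → Branch E) : (vertex N O legs).field H k =
      propagate H ‖∑ i, (legs i).momentum k‖ (O.timeDeriv 0) (source H k O legs) := rfl

theorem differentiableOn_source {H : ℝ} (hH : 0 < H) {k : Fin E → Vec3} {N : ℕ}
    (O : LocalOperator (N + 1)) {legs : Fin N → Branch E}
    (h : ∀ i, DifferentiableOn ℂ ((legs i).field H k) upperHalf) :
    DifferentiableOn ℂ (source H k O legs) upperHalf :=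
  (differentiableOn_vertexFactor H O _ hH).mul (DifferentiableOn.fun_finsetProd fun i _ =>
    differentiableOn_iteratedDeriv (h i) _)

theorem differentiableOn_field {H : ℝ} (hH : 0 < H) {k : Fin E → Vec3} (b : Branch E)
    (hb : b.Converges H k) : DifferentiableOn ℂ (b.field H k) upperHalf := by
  induction b with
  | external e => exact (differentiable_bulkToBoundary _).differentiableOn
  | vertex N O legs ih =>
    exact differentiableOn_propagate (differentiableOn_source hH O fun i => ih i (hb.1 i)) hb.2

theorem isPhase_field {H : ℝ} (hH : 0 < H) {k : Fin E → Vec3} (b : Branch E)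
    (hb : b.Converges H k) {x : ℝ} (hx : 0 < x) : IsPhase 0 (b.field H k (x * Complex.I)) := by
  induction b generalizing x with
  | external e => exact isPhase_bulkToBoundary _ x
  | vertex N O legs ih =>
    have hdiff := fun i => differentiableOn_field hH _ (hb.1 i)
    refine isPhase_propagate (differentiableOn_source hH O hdiff) (fun y hy => ?_) hx
    refine ((isPhase_vertexFactor H O _ y).mul (IsPhase.prod fun i _ =>
      IsPhase.iteratedDeriv (hdiff i) (fun z hz => ih i (hb.1 i) hz)
        (O.timeDeriv i.succ) hy)).congr ?_
    -- The time derivatives on the outer legs cancel their share of `n`; those on factor `0` remain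
    -- and give the exponent `1 + b` that `isPhase_propagate` asks for.
    refine ⟨0, ?_⟩
    rw [LocalOperator.n, Fin.sum_univ_succ]
    simp only [zero_sub, Finset.sum_neg_distrib]
    push_cast
    ring

theorem momentum_neg (k : Fin E → Vec3) (b : Branch E) : b.momentum (-k) = -b.momentum k := by
  induction b with
  | external e => rfl
  | vertex N O legs ih => simp only [momentum, ih, Finset.sum_neg_distrib]

end Branch

/-- Paired derivatives are quadratic in the momenta; the determinant is cubic. -/
theorem LocalOperator.spatial_neg {N : ℕ} (O : LocalOperator N) (p : Fin N → Vec3) :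
    O.spatial (-p) = (-1) ^ (if O.eps.isSome then 1 else 0) * O.spatial p := by
  rcases he : O.eps with _ | t
  · simp [spatial, he]
  · have : (Matrix.of fun (a i : Fin 3) => (-p) (t a) i) =
        -(Matrix.of fun (a i : Fin 3) => p (t a) i) := by
      ext; simp
    simp only [spatial, he, this, Matrix.det_neg]
    simp
    ring

theorem vertexFactor_neg {N : ℕ} (H : ℝ) (O : LocalOperator N) (p : Fin N → Vec3) (τ : ℂ) :
    vertexFactor H O (-p) τ =
      (-1) ^ (if O.eps.isSome then 1 else 0) * vertexFactor H O p τ := by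
  rw [vertexFactor, vertexFactor, LocalOperator.spatial_neg]
  ring

theorem propagate_const_mul (H k : ℝ) (b : ℕ) (c : ℂ) (S : ℂ → ℂ) :
    propagate H k b (fun τ => c * S τ) = fun τ => c * propagate H k b S τ := by
  funext τ
  rw [propagate, propagate, mul_add, mul_neg, ← integral_const_mul, Finset.mul_sum]
  congr 1
  · congr 1
    refine integral_congr_ae (Eventually.of_forall fun s => ?_)
    ring
  · refine Finset.sum_congr rfl fun j _ => ?_
    rw [iteratedDeriv_const_mul_field]
    ring

namespace Branch

variable {E : ℕ}

/-- Propagators see only norms of momenta, so signs arise at the vertices alone and factor out of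
the linear map `propagate`. -/
theorem field_neg (H : ℝ) (k : Fin E → Vec3) (b : Branch E) :
    b.field H (-k) = fun τ => (-1) ^ b.numOdd * b.field H k τ := by
  induction b with
  | external e => funext τ; simp [field, numOdd]
  | vertex N O legs ih =>
    rw [field_vertex, field_vertex, ← propagate_const_mul]
    simp only [momentum_neg, Finset.sum_neg_distrib, norm_neg]
    congr 1
    funext τ
    have hp : (Fin.cons (- -∑ i, (legs i).momentum k) fun i => -(legs i).momentum k :
        Fin (N + 1) → Vec3) =
        -Fin.cons (-∑ i, (legs i).momentum k) fun i => (legs i).momentum k := by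
      funext i
      refine Fin.cases ?_ (fun i => ?_) i <;> simp
    simp only [source, momentum_neg, Finset.sum_neg_distrib, hp, vertexFactor_neg, ih,
      iteratedDeriv_const_mul_field, Finset.prod_mul_distrib, Finset.prod_pow_eq_pow_sum, numOdd,
      pow_add]
    ring

end Branch

namespace TreeDiagram

variable {E : ℕ}

theorem integrand_neg (H : ℝ) (D : TreeDiagram E) (k : Fin E → Vec3) (τ : ℂ) :
    D.integrand H (-k) τ = (-1) ^ D.numOdd * D.integrand H k τ := by
  have hp : (fun i => -(D.legs i).momentum k) = -fun i => (D.legs i).momentum k := rfl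
  simp only [integrand, Branch.momentum_neg, hp, vertexFactor_neg, Branch.field_neg,
    iteratedDeriv_const_mul_field, Finset.prod_mul_distrib, Finset.prod_pow_eq_pow_sum, numOdd,
    pow_add]
  ring

theorem regulated_neg (H : ℝ) (D : TreeDiagram E) (k : Fin E → Vec3) (ω : ℂ) :
    D.regulated H (-k) ω = (-1) ^ D.numOdd * D.regulated H k ω := by
  rw [regulated, regulated, rayIntegral, rayIntegral, mul_neg, ← integral_const_mul]
  congr 1
  refine integral_congr_ae (Eventually.of_forall fun s => ?_)
  simp only [integrand_neg]
  ring

theorem differentiableOn_integrand {H : ℝ} (hH : 0 < H) (D : TreeDiagram E) {k : Fin E → Vec3}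
    (h : ∀ i, (D.legs i).Converges H k) : DifferentiableOn ℂ (D.integrand H k) upperHalf :=
  (differentiableOn_vertexFactor H D.O _ hH).mul (DifferentiableOn.fun_finsetProd fun i _ =>
    differentiableOn_iteratedDeriv (Branch.differentiableOn_field hH _ (h i)) _)

theorem isPhase_integrand {H : ℝ} (hH : 0 < H) (D : TreeDiagram E) {k : Fin E → Vec3}
    (h : ∀ i, (D.legs i).Converges H k) {x : ℝ} (hx : 0 < x) :
    IsPhase 1 (D.integrand H k (x * Complex.I)) := by
  refine ((isPhase_vertexFactor H D.O _ x).mul (IsPhase.prod fun i _ =>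
    IsPhase.iteratedDeriv (Branch.differentiableOn_field hH _ (h i))
      (fun z hz => Branch.isPhase_field hH _ (h i) hz) (D.O.timeDeriv i) hx)).congr ?_
  refine ⟨0, ?_⟩
  rw [LocalOperator.n]
  simp only [zero_sub, Finset.sum_neg_distrib]
  push_cast
  ring

/-- Reality holds for any number of P-odd vertices; parity plays no role here. -/
theorem isPhase_regulated_I {H : ℝ} (hH : 0 < H) (D : TreeDiagram E) {k : Fin E → Vec3}
    (h : ∀ i, (D.legs i).Converges H k) : IsPhase 0 (D.regulated H k Complex.I) := by
  refine (IsPhase.integral measurableSet_Ioi fun s hs => ?_).neg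
  exact (IsPhase.I.mul (isPhase_integrand hH D h hs)).congr ⟨-1, by ring⟩

theorem regulated_contour {H : ℝ} (hH : 0 < H) {D : TreeDiagram E} {k : Fin E → Vec3}
    (h : D.Converges H k) {ε : ℝ} (hε : 0 < ε) :
    D.regulated H k (contour ε) = D.regulated H k Complex.I :=
  rayIntegral_eq (differentiableOn_integrand hH D h.1) h.2 (contour_mem_upperHalf hε)
    (by simp [upperHalf])

/-- If the diagram does not depend on the regulator then the regulator can be removed. -/
theorem tendsto_psi {H : ℝ} {D : TreeDiagram E} {k : Fin E → Vec3} {a : ℂ}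
    (h : ∀ ε : ℝ, 0 < ε → D.regulated H k (contour ε) = a) :
    Tendsto (fun ε : ℝ => D.regulated H k (contour ε)) (𝓝[>] 0) (𝓝 (D.psi H k)) ∧
      D.psi H k = a := by
  have h1 : Tendsto (fun ε : ℝ => D.regulated H k (contour ε)) (𝓝[>] 0) (𝓝 a) := by
    refine tendsto_const_nhds.congr' ?_
    filter_upwards [self_mem_nhdsWithin] with ε hε using (h ε hε).symm
  have h2 : D.psi H k = a := h1.limUnder_eq
  exact ⟨h2 ▸ h1, h2⟩

/-- The defining limit of `psi`, its reality, and its parity. -/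
theorem psi_of_converges {H : ℝ} (hH : 0 < H) {D : TreeDiagram E} (hodd : Odd D.numOdd)
    {k : Fin E → Vec3} (h : D.Converges H k) :
    Tendsto (fun ε : ℝ => D.regulated H k (contour ε)) (𝓝[>] 0) (𝓝 (D.psi H k)) ∧
      (D.psi H k).im = 0 ∧ D.psi H (-k) = -D.psi H k := by
  obtain ⟨h1, h2⟩ := tendsto_psi fun ε hε => regulated_contour hH h hε
  refine ⟨h1, h2 ▸ (isPhase_regulated_I hH D h.1).im_eq_zero, ?_⟩
  rw [h2, ← neg_one_mul, ← hodd.neg_one_pow]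
  -- Convergence is known only at `k`. The regulated diagram at `-k` is a sign times the one at `k`
  -- for every `ε`, so no separate argument is needed there.
  exact (tendsto_psi fun ε hε => by rw [regulated_neg, regulated_contour hH h hε]).2

end TreeDiagram

/-! ### Correlators -/

theorem rePrime_eq_zero {N : ℕ} {ψ : (Fin N → Vec3) → ℂ} {k : Fin N → Vec3}
    (him : (ψ k).im = 0) (hodd : ψ (-k) = -ψ k) : rePrime ψ k = 0 := by
  rw [rePrime, hodd, map_neg, Complex.conj_eq_iff_im.2 him]
  simp

theorem correlator_eq_zero {N : ℕ} (H : ℝ) {ψ : (Fin N → Vec3) → ℂ} {k : Fin N → Vec3}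
    (him : (ψ k).im = 0) (hodd : ψ (-k) = -ψ k) : correlator H ψ k = 0 := by
  rw [correlator, rePrime_eq_zero him hodd]
  simp

/-! ### Functions that decay in sectors, together with all derivatives -/

/-- Exponential decay in every closed sector of the upper half-plane, uniformly down to `0`. -/
def ExpDecays (f : ℂ → ℂ) : Prop :=
  ∀ δ : ℝ, 0 < δ → ∃ C c : ℝ, 0 ≤ C ∧ 0 < c ∧
    ∀ τ ∈ upperHalf, δ * ‖τ‖ ≤ τ.im → ‖f τ‖ ≤ C * Real.exp (-c * ‖τ‖)

/-- Subexponential growth in every closed sector of the upper half-plane, uniformly down to `0`. -/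
def Subexp (f : ℂ → ℂ) : Prop :=
  ∀ δ : ℝ, 0 < δ → ∀ c : ℝ, 0 < c → ∃ C : ℝ, 0 ≤ C ∧
    ∀ τ ∈ upperHalf, δ * ‖τ‖ ≤ τ.im → ‖f τ‖ ≤ C * Real.exp (c * ‖τ‖)

/-- `W` is a class of functions on the upper half-plane that is closed under linear operations. -/
structure IsLinearClass (W : (ℂ → ℂ) → Prop) : Prop where
  congr : ∀ {f g}, W f → Set.EqOn f g upperHalf → W g
  add : ∀ {f g}, W f → W g → W fun τ => f τ + g τ
  const_mul : ∀ {f} (a : ℂ), W f → W fun τ => a * f τ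

theorem isLinearClass_expDecays : IsLinearClass ExpDecays where
  congr := by
    intro f g hf h δ hδ
    obtain ⟨C, c, hC, hc, hb⟩ := hf δ hδ
    exact ⟨C, c, hC, hc, fun τ hτ hs => h hτ ▸ hb τ hτ hs⟩
  add := by
    intro f g hf hg δ hδ
    obtain ⟨C, c, hC, hc, hb⟩ := hf δ hδ
    obtain ⟨C', c', hC', hc', hb'⟩ := hg δ hδ
    refine ⟨C + C', min c c', by positivity, lt_min hc hc', fun τ hτ hs => ?_⟩
    refine (norm_add_le _ _).trans ?_
    rw [add_mul]
    refine add_le_add ((hb τ hτ hs).trans ?_) ((hb' τ hτ hs).trans ?_)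
    · gcongr
      exact min_le_left _ _
    · gcongr
      exact min_le_right _ _
  const_mul := by
    intro f a hf δ hδ
    obtain ⟨C, c, hC, hc, hb⟩ := hf δ hδ
    refine ⟨‖a‖ * C, c, by positivity, hc, fun τ hτ hs => ?_⟩
    rw [norm_mul, mul_assoc]
    gcongr
    exact hb τ hτ hs

theorem isLinearClass_subexp : IsLinearClass Subexp where
  congr := by
    intro f g hf h δ hδ c hc
    obtain ⟨C, hC, hb⟩ := hf δ hδ c hc
    exact ⟨C, hC, fun τ hτ hs => h hτ ▸ hb τ hτ hs⟩
  add := by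
    intro f g hf hg δ hδ c hc
    obtain ⟨C, hC, hb⟩ := hf δ hδ c hc
    obtain ⟨C', hC', hb'⟩ := hg δ hδ c hc
    refine ⟨C + C', by positivity, fun τ hτ hs => (norm_add_le _ _).trans ?_⟩
    rw [add_mul]
    exact add_le_add (hb τ hτ hs) (hb' τ hτ hs)
  const_mul := by
    intro f a hf δ hδ c hc
    obtain ⟨C, hC, hb⟩ := hf δ hδ c hc
    refine ⟨‖a‖ * C, by positivity, fun τ hτ hs => ?_⟩
    rw [norm_mul, mul_assoc]
    gcongr
    exact hb τ hτ hs

theorem ExpDecays.mul_subexp {f g : ℂ → ℂ} (hf : ExpDecays f) (hg : Subexp g) :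
    ExpDecays fun τ => f τ * g τ := by
  intro δ hδ
  obtain ⟨C, c, hC, hc, hb⟩ := hf δ hδ
  obtain ⟨C', hC', hb'⟩ := hg δ hδ (c / 2) (by positivity)
  refine ⟨C * C', c / 2, by positivity, by positivity, fun τ hτ hs => ?_⟩
  rw [norm_mul]
  refine (mul_le_mul (hb τ hτ hs) (hb' τ hτ hs) (norm_nonneg _) (by positivity)).trans_eq ?_
  rw [mul_mul_mul_comm, ← Real.exp_add]
  ring_nf

theorem Subexp.mul {f g : ℂ → ℂ} (hf : Subexp f) (hg : Subexp g) :
    Subexp fun τ => f τ * g τ := by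
  intro δ hδ c hc
  obtain ⟨C, hC, hb⟩ := hf δ hδ (c / 2) (by positivity)
  obtain ⟨C', hC', hb'⟩ := hg δ hδ (c / 2) (by positivity)
  refine ⟨C * C', by positivity, fun τ hτ hs => ?_⟩
  rw [norm_mul]
  refine (mul_le_mul (hb τ hτ hs) (hb' τ hτ hs) (norm_nonneg _) (by positivity)).trans_eq ?_
  rw [mul_mul_mul_comm, ← Real.exp_add]
  ring_nf

theorem ExpDecays.subexp {f : ℂ → ℂ} (hf : ExpDecays f) : Subexp f := by
  intro δ hδ c hc
  obtain ⟨C, c', hC, hc', hb⟩ := hf δ hδ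
  refine ⟨C, hC, fun τ hτ hs => (hb τ hτ hs).trans ?_⟩
  gcongr
  linarith

theorem subexp_const (a : ℂ) : Subexp fun _ => a := by
  intro δ hδ c hc
  refine ⟨‖a‖, norm_nonneg _, fun τ hτ hs => le_mul_of_one_le_right (norm_nonneg _) ?_⟩
  exact Real.one_le_exp (by positivity)

theorem subexp_id : Subexp fun τ => τ := by
  intro δ hδ c hc
  refine ⟨1 / c, by positivity, fun τ hτ hs => ?_⟩
  rw [one_div, inv_mul_eq_div, le_div_iff₀ hc]
  linarith [Real.add_one_le_exp (c * ‖τ‖)]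

theorem norm_exp_I_mul (k : ℝ) (τ : ℂ) :
    ‖Complex.exp (Complex.I * k * τ)‖ = Real.exp (-(k * τ.im)) := by
  rw [Complex.norm_exp]
  simp

theorem subexp_exp {k : ℝ} (hk : 0 ≤ k) : Subexp fun τ => Complex.exp (Complex.I * k * τ) := by
  intro δ hδ c hc
  refine ⟨1, zero_le_one, fun τ hτ hs => ?_⟩
  have hτ' : 0 < τ.im := hτ
  rw [norm_exp_I_mul, one_mul]
  exact Real.exp_le_exp.2 ((neg_nonpos.2 (by positivity)).trans (by positivity))

theorem expDecays_exp {k : ℝ} (hk : 0 < k) :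
    ExpDecays fun τ => Complex.exp (Complex.I * k * τ) := by
  intro δ hδ
  refine ⟨1, k * δ, zero_le_one, by positivity, fun τ hτ hs => ?_⟩
  rw [norm_exp_I_mul, one_mul, neg_mul, mul_assoc]
  gcongr

/-- `f` is holomorphic and all its derivatives are in the class `W`. -/
def Tame (W : (ℂ → ℂ) → Prop) (f : ℂ → ℂ) : Prop :=
  DifferentiableOn ℂ f upperHalf ∧ ∀ n, W (iteratedDeriv n f)

namespace Tame

variable {W W₁ W₂ : (ℂ → ℂ) → Prop} {f g : ℂ → ℂ}

theorem mem (hf : Tame W f) : W f := by simpa using hf.2 0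

theorem congr (hW : IsLinearClass W) (hf : Tame W f) (h : Set.EqOn f g upperHalf) : Tame W g :=
  ⟨hf.1.congr fun _ hτ => (h hτ).symm,
    fun n => hW.congr (hf.2 n) (h.iteratedDeriv_of_isOpen isOpen_upperHalf n)⟩

theorem add (hW : IsLinearClass W) (hf : Tame W f) (hg : Tame W g) :
    Tame W fun τ => f τ + g τ :=
  ⟨hf.1.add hg.1, fun n => hW.congr (hW.add (hf.2 n) (hg.2 n)) fun _ hτ =>
    (iteratedDeriv_fun_add (contDiffAt_of_differentiableOn_upperHalf hf.1 hτ n)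
      (contDiffAt_of_differentiableOn_upperHalf hg.1 hτ n)).symm⟩

theorem const_mul (hW : IsLinearClass W) (a : ℂ) (hf : Tame W f) : Tame W fun τ => a * f τ :=
  ⟨hf.1.const_mul a, fun n => hW.congr (hW.const_mul a (hf.2 n)) fun _ _ =>
    (iteratedDeriv_const_mul_field a f).symm⟩

theorem mul (hW : IsLinearClass W) (hmul : ∀ f g, W₁ f → W₂ g → W fun τ => f τ * g τ)
    (hf : Tame W₁ f) (hg : Tame W₂ g) : Tame W fun τ => f τ * g τ := by
  refine ⟨hf.1.mul hg.1, fun n => ?_⟩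
  -- `IsLinearClass` does not postulate the zero function, hence the induction over nonempty index
  -- sets for the Leibniz sum.
  have h : ∀ (s : Finset ℕ) (F : ℕ → ℂ → ℂ), s.Nonempty → (∀ i ∈ s, W (F i)) →
      W fun τ => ∑ i ∈ s, F i τ := by
    intro s F hs hF
    induction hs using Finset.Nonempty.cons_induction with
    | singleton a => simpa using hF a (by simp)
    | cons a s ha hs ih =>
      simp_rw [Finset.sum_cons]
      exact hW.add (hF a (by simp)) (ih fun i hi => hF i (by simp [hi]))
  refine hW.congr (h (Finset.range (n + 1)) (fun i τ => n.choose i *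
    (iteratedDeriv i f τ * iteratedDeriv (n - i) g τ)) (by simp) fun i _ =>
      hW.const_mul _ (hmul _ _ (hf.2 i) (hg.2 (n - i)))) fun τ hτ => ?_
  rw [iteratedDeriv_fun_mul (contDiffAt_of_differentiableOn_upperHalf hf.1 hτ n)
    (contDiffAt_of_differentiableOn_upperHalf hg.1 hτ n)]
  exact Finset.sum_congr rfl fun i _ => (mul_assoc _ _ _).symm

theorem iteratedDeriv (hf : Tame W f) (m : ℕ) : Tame W (iteratedDeriv m f) := by
  refine ⟨differentiableOn_iteratedDeriv hf.1 m, fun n => ?_⟩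
  have := hf.2 (n + m)
  rwa [iteratedDeriv_eq_iterate, Function.iterate_add_apply, ← iteratedDeriv_eq_iterate,
    ← iteratedDeriv_eq_iterate] at this

/-- Solutions of a first-order linear differential equation with a source in the class. -/
theorem of_hasDerivAt (hW : IsLinearClass W) (hf : Tame W f) (hg : W g) {a b : ℂ}
    (h : ∀ τ ∈ upperHalf, HasDerivAt g (a * g τ + b * f τ) τ) : Tame W g := by
  have hd : DifferentiableOn ℂ g upperHalf := fun τ hτ =>
    (h τ hτ).differentiableAt.differentiableWithinAt
  refine ⟨hd, fun n => ?_⟩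
  induction n with
  | zero => simpa using hg
  | succ n ih =>
    rw [iteratedDeriv_succ']
    refine hW.congr (hW.add (hW.const_mul a ih) (hW.const_mul b (hf.2 n))) fun τ hτ => ?_
    -- Differentiating the equation `n` times expresses derivative `n + 1` of `g` through derivative
    -- `n` of `g` and of `f`.
    have heq : Set.EqOn (fun τ => a * g τ + b * f τ) (deriv g) upperHalf :=
      fun τ hτ => (h τ hτ).deriv.symm
    have := heq.iteratedDeriv_of_isOpen isOpen_upperHalf n hτ
    rw [← this, iteratedDeriv_fun_add
      (contDiffAt_of_differentiableOn_upperHalf (hd.const_mul a) hτ n)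
      (contDiffAt_of_differentiableOn_upperHalf (hf.1.const_mul b) hτ n),
      iteratedDeriv_const_mul_field, iteratedDeriv_const_mul_field]

theorem const (a : ℂ) : Tame Subexp fun _ => a := by
  refine ⟨differentiableOn_const a, fun n => ?_⟩
  have : _root_.iteratedDeriv n (fun _ : ℂ => a) = fun _ => if n = 0 then a else 0 :=
    funext fun x => iteratedDeriv_const
  rw [this]
  exact subexp_const _

theorem id : Tame Subexp fun τ => τ := by
  refine ⟨differentiableOn_id, fun n => ?_⟩
  simp_rw [funext fun x => iteratedDeriv_fun_id (𝕜 := ℂ) (n := n) (x := x)]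
  split_ifs
  · exact subexp_id
  · exact subexp_const _
  · exact subexp_const _

theorem mul_subexp (hf : Tame Subexp f) (hg : Tame Subexp g) : Tame Subexp fun τ => f τ * g τ :=
  mul isLinearClass_subexp (fun _ _ => Subexp.mul) hf hg

theorem decay_mul (hf : Tame ExpDecays f) (hg : Tame Subexp g) :
    Tame ExpDecays fun τ => f τ * g τ :=
  mul isLinearClass_expDecays (fun _ _ => ExpDecays.mul_subexp) hf hg

theorem mul_decay (hf : Tame Subexp f) (hg : Tame ExpDecays g) :
    Tame ExpDecays fun τ => f τ * g τ := by
  simp_rw [mul_comm (f _)]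
  exact hg.decay_mul hf

theorem subexp (hf : Tame ExpDecays f) : Tame Subexp f := ⟨hf.1, fun n => (hf.2 n).subexp⟩

theorem affine (a b : ℂ) : Tame Subexp fun τ => a + b * τ :=
  (const a).add isLinearClass_subexp (id.const_mul isLinearClass_subexp b)

theorem pow (hf : Tame Subexp f) (n : ℕ) : Tame Subexp fun τ => f τ ^ n := by
  induction n with
  | zero => simpa using const 1
  | succ n ih => simpa only [pow_succ] using ih.mul_subexp hf

theorem prod {ι : Type*} {s : Finset ι} {F : ι → ℂ → ℂ} (h : ∀ i ∈ s, Tame Subexp (F i)) :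
    Tame Subexp fun τ => ∏ i ∈ s, F i τ := by
  classical
  induction s using Finset.induction_on with
  | empty => simpa using const 1
  | insert a s ha ih =>
    simp_rw [Finset.prod_insert ha]
    exact (h a (by simp)).mul_subexp (ih fun i hi => h i (by simp [hi]))

theorem prod_decay {ι : Type*} [Fintype ι] {F : ι → ℂ → ℂ} (h : ∀ i, Tame Subexp (F i)) (i : ι)
    (hi : Tame ExpDecays (F i)) : Tame ExpDecays fun τ => ∏ i, F i τ := by
  classical
  simp_rw [← Finset.mul_prod_erase Finset.univ _ (Finset.mem_univ i)]
  exact hi.decay_mul (prod fun j _ => h j)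

end Tame

theorem tame_bulkToBoundary {k : ℝ} (hk : 0 < k) : Tame ExpDecays (bulkToBoundary k) := by
  refine ⟨(differentiable_bulkToBoundary k).differentiableOn, fun n => ?_⟩
  rw [iteratedDeriv_bulkToBoundary]
  refine isLinearClass_expDecays.congr ((expDecays_exp hk).mul_subexp (Tame.affine
    ((Complex.I * k) ^ n * (1 - n)) (-(Complex.I * k) ^ n * (Complex.I * k))).mem) fun τ _ => ?_
  ring

/-- The case `k = 0`, where the propagator is `1`, serves the contact diagrams on all of momentum
space, some of whose legs may have zero momentum. -/
theorem tame_subexp_bulkToBoundary {k : ℝ} (hk : 0 ≤ k) : Tame Subexp (bulkToBoundary k) := by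
  rcases hk.eq_or_lt with rfl | hk
  · have : bulkToBoundary 0 = fun _ => 1 := by funext τ; simp [bulkToBoundary]
    rw [this]
    exact Tame.const 1
  · exact (tame_bulkToBoundary hk).subexp

theorem scaleFactor_zpow_neg (H : ℝ) (q : ℕ) (τ : ℂ) :
    scaleFactor H τ ^ (-(q : ℤ)) = (-H * τ) ^ q := by
  rw [scaleFactor, zpow_neg, zpow_natCast, ← inv_pow, inv_div, div_neg, div_one, neg_mul]

/-- A nonpositive power of `a` is a monomial in `τ`; a positive one would be singular at the future
boundary. -/
theorem tame_scaleFactor_zpow (H : ℝ) {p : ℤ} (hp : p ≤ 0) :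
    Tame Subexp fun τ => scaleFactor H τ ^ p := by
  obtain ⟨q, rfl⟩ : ∃ q : ℕ, p = -q := ⟨p.natAbs, by omega⟩
  simp_rw [scaleFactor_zpow_neg]
  exact (Tame.id.const_mul isLinearClass_subexp _).pow q

theorem tame_vertexFactor {N : ℕ} (H : ℝ) {O : LocalOperator N} (hO : O.scalePower ≤ 0)
    (p : Fin N → Vec3) : Tame Subexp (vertexFactor H O p) :=
  (tame_scaleFactor_zpow H hO).const_mul isLinearClass_subexp _

/-- At coincident times the exponentials of `K(-k)` and `K(k)` cancel, so the jump is a polynomial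
in `τ`. -/
theorem tame_bulkJump (H k : ℝ) (j : ℕ) : Tame Subexp (bulkJump H k j) := by
  have h : bulkJump H k j = fun τ => (H : ℂ) ^ 2 / (2 * (k : ℂ) ^ 3) *
      ((((-Complex.I * k) ^ j * (1 - j)) + ((-Complex.I * k) ^ j * (Complex.I * k)) * τ) *
        (1 + (-Complex.I * k) * τ) +
      (-((Complex.I * k) ^ j * (1 - j)) + ((Complex.I * k) ^ j * (Complex.I * k)) * τ) *
        (1 + (Complex.I * k) * τ)) := by
    funext τ
    rw [bulkJump_eq, iteratedDeriv_bulkToBoundary, iteratedDeriv_bulkToBoundary, bulkToBoundary,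
      bulkToBoundary]
    have h1 : Complex.I * (-k : ℝ) * τ = -(Complex.I * k * τ) := by push_cast; ring
    have h2 : Complex.exp (-(Complex.I * k * τ)) * Complex.exp (Complex.I * k * τ) = 1 := by
      rw [← Complex.exp_add, neg_add_cancel, Complex.exp_zero]
    beta_reduce
    rw [h1]
    congr 1
    push_cast
    linear_combination ((-Complex.I * k) ^ j * (1 - j + Complex.I * k * τ) *
      (1 - Complex.I * k * τ) - (Complex.I * k) ^ j * (1 - j - Complex.I * k * τ) *
      (1 + Complex.I * k * τ)) * h2
  rw [h]
  exact (((Tame.affine _ _).mul_subexp (Tame.affine _ _)).add isLinearClass_subexp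
    ((Tame.affine _ _).mul_subexp (Tame.affine _ _))).const_mul isLinearClass_subexp _

/-! ### Decay along rays -/

/-- Nearby directions share one sector and lie in an annulus, which turns sectorial bounds into
locally uniform bounds along rays. The slope is half of that of `τ₀`, to leave room. -/
theorem eventually_sector {τ₀ : ℂ} (h : τ₀ ∈ upperHalf) : ∃ δ ρ : ℝ, 0 < δ ∧ 0 < ρ ∧
    ∀ᶠ τ in 𝓝 τ₀, τ ∈ upperHalf ∧ δ * ‖τ‖ ≤ τ.im ∧ ρ ≤ ‖τ‖ ∧ ‖τ‖ ≤ ‖τ₀‖ + 1 := by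
  have him : 0 < τ₀.im := h
  have hn : 0 < ‖τ₀‖ := norm_pos_iff.2 (ne_zero_of_mem_upperHalf h)
  refine ⟨τ₀.im / 2 / ‖τ₀‖, ‖τ₀‖ / 2, by positivity, by positivity, ?_⟩
  have h1 : ∀ᶠ τ : ℂ in 𝓝 τ₀, τ₀.im / 2 / ‖τ₀‖ * ‖τ‖ < τ.im := by
    refine ContinuousAt.eventually_lt (by fun_prop) Complex.continuous_im.continuousAt ?_
    rw [div_mul_cancel₀ _ hn.ne']
    linarith
  have h2 : ∀ᶠ τ : ℂ in 𝓝 τ₀, ‖τ₀‖ / 2 < ‖τ‖ :=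
    continuousAt_const.eventually_lt continuous_norm.continuousAt (by linarith)
  have h3 : ∀ᶠ τ : ℂ in 𝓝 τ₀, ‖τ‖ < ‖τ₀‖ + 1 :=
    continuous_norm.continuousAt.eventually_lt continuousAt_const (by linarith)
  filter_upwards [upperHalf_mem_nhds h, h1, h2, h3] with τ a b c d using ⟨a, b.le, c.le, d.le⟩

theorem sector_ofReal_mul {δ s : ℝ} (hs : 0 < s) {τ : ℂ} (h : δ * ‖τ‖ ≤ τ.im) :
    δ * ‖(s : ℂ) * τ‖ ≤ ((s : ℂ) * τ).im := by
  rw [norm_mul, Complex.norm_real, Real.norm_of_nonneg hs.le, Complex.im_ofReal_mul]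
  nlinarith

theorem ExpDecays.ray {f : ℂ → ℂ} (hf : ExpDecays f) {τ₀ : ℂ} (h : τ₀ ∈ upperHalf) :
    ∃ C c : ℝ, 0 ≤ C ∧ 0 < c ∧
      ∀ᶠ τ in 𝓝 τ₀, ∀ s : ℝ, 0 < s → ‖f ((s : ℂ) * τ)‖ ≤ C * Real.exp (-c * s) := by
  obtain ⟨δ, ρ, hδ, hρ, hev⟩ := eventually_sector h
  obtain ⟨C, c, hC, hc, hb⟩ := hf δ hδ
  refine ⟨C, c * ρ, hC, by positivity, ?_⟩
  filter_upwards [hev] with τ ⟨h1, h2, h3, _⟩ s hs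
  refine (hb _ (ofReal_mul_mem_upperHalf hs h1) (sector_ofReal_mul hs h2)).trans ?_
  rw [norm_mul, Complex.norm_real, Real.norm_of_nonneg hs.le]
  gcongr ?_ * Real.exp ?_
  nlinarith [mul_le_mul_of_nonneg_left h3 (mul_pos hc hs).le]

theorem ExpDecays.rayDominated {f : ℂ → ℂ} (hf : ExpDecays f) : RayDominated f := by
  intro ω₀ h
  obtain ⟨C, c, -, hc, hb⟩ := hf.ray h
  exact ⟨_, (exp_neg_integrableOn_Ioi 0 hc).const_mul C, hb⟩

theorem integrableOn_ray {f : ℂ → ℂ} (hf : DifferentiableOn ℂ f upperHalf) (hd : RayDominated f)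
    {τ : ℂ} (hτ : τ ∈ upperHalf) :
    IntegrableOn (fun s : ℝ => f ((s : ℂ) * τ)) (Set.Ioi 0) := by
  obtain ⟨g, hg, hb⟩ := hd τ hτ
  exact Integrable.mono' hg (aestronglyMeasurable_ray hf hτ)
    ((ae_restrict_iff' measurableSet_Ioi).2 (Eventually.of_forall hb.self_of_nhds))

/-- For `s > 1` the growing exponential sits at `τ`, which stays in a compact set; for `s ≤ 1` it
sits at `sτ`, which stays in the same ball. The decay in `s` comes from the source. -/
theorem propagateDominated_of_expDecays (H : ℝ) {k : ℝ} (b : ℕ) {S : ℂ → ℂ} (hk : 0 < k)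
    (hS : ExpDecays S) : PropagateDominated H k b S := by
  intro τ₀ hτ₀
  have hKd := (tame_bulkToBoundary hk).2 b
  obtain ⟨C₁, c₁, hC₁, hc₁, h₁⟩ := (hKd.mul_subexp hS.subexp).ray hτ₀
  obtain ⟨C₂, c₂, hC₂, hc₂, h₂⟩ := hS.ray hτ₀
  set q : ℂ := (H : ℂ) ^ 2 / (2 * (k : ℂ) ^ 3)
  have hB := fun k => (differentiable_bulkToBoundary k).continuous
  have hB' := fun k => continuous_iteratedDeriv_bulkToBoundary k b
  obtain ⟨M₁, hM₁⟩ := (isCompact_closedBall (0 : ℂ) (‖τ₀‖ + 1)).exists_bound_of_continuousOn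
    (f := fun τ => q * (bulkToBoundary (-k) τ - bulkToBoundary k τ))
    (((hB _).sub (hB _)).const_mul _).continuousOn
  obtain ⟨M₂, hM₂⟩ := (isCompact_closedBall (0 : ℂ) (‖τ₀‖ + 1)).exists_bound_of_continuousOn
    (f := fun τ => q * (iteratedDeriv b (bulkToBoundary (-k)) τ -
      iteratedDeriv b (bulkToBoundary k) τ))
    (((hB' _).sub (hB' _)).const_mul _).continuousOn
  obtain ⟨M₃, hM₃⟩ := (isCompact_closedBall (0 : ℂ) (‖τ₀‖ + 1)).exists_bound_of_continuousOn
    (f := bulkToBoundary k) (hB k).continuousOn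
  have h0 : (0 : ℂ) ∈ Metric.closedBall (0 : ℂ) (‖τ₀‖ + 1) := by
    simp only [Metric.mem_closedBall, dist_self]; positivity
  have hM₁' := (norm_nonneg _).trans (hM₁ 0 h0)
  have hM₂' := (norm_nonneg _).trans (hM₂ 0 h0)
  have hM₃' := (norm_nonneg _).trans (hM₃ 0 h0)
  refine ⟨fun s => M₁ * (C₁ * Real.exp (-c₁ * s)) + M₂ * M₃ * (C₂ * Real.exp (-c₂ * s)),
    (((exp_neg_integrableOn_Ioi 0 hc₁).const_mul _).const_mul _).add
    (((exp_neg_integrableOn_Ioi 0 hc₂).const_mul _).const_mul _), ?_⟩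
  obtain ⟨δ, ρ, -, -, hev⟩ := eventually_sector hτ₀
  filter_upwards [h₁, h₂, hev] with τ e₁ e₂ ⟨_, _, _, hn⟩ s hs
  have hτb : τ ∈ Metric.closedBall (0 : ℂ) (‖τ₀‖ + 1) := by simpa using hn
  have hr₁ : 0 ≤ M₁ * (C₁ * Real.exp (-c₁ * s)) := by positivity
  have hr₂ : 0 ≤ M₂ * M₃ * (C₂ * Real.exp (-c₂ * s)) := by positivity
  rcases lt_or_ge 1 s with hs1 | hs1
  · rw [bulkDeriv_of_one_lt H k b τ hs1, ← mul_assoc, mul_assoc, norm_mul]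
    exact (mul_le_mul (hM₁ τ hτb) (e₁ s hs) (norm_nonneg _) hM₁').trans (by linarith)
  · rw [bulkDeriv_of_le_one H k b τ hs1, ← mul_assoc, norm_mul, norm_mul]
    have hsb : (s : ℂ) * τ ∈ Metric.closedBall (0 : ℂ) (‖τ₀‖ + 1) := by
      rw [mem_closedBall_zero_iff, norm_mul, Complex.norm_real, Real.norm_of_nonneg hs.le]
      exact (mul_le_of_le_one_left (norm_nonneg _) hs1).trans hn
    exact (mul_le_mul (mul_le_mul (hM₂ _ hsb) (hM₃ τ hτb) (norm_nonneg _) hM₂') (e₂ s hs)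
      (norm_nonneg _) (by positivity)).trans (by linarith)

/-! ### Primitives -/

/-- `∫_0^τ f`, along the ray through `τ`. -/
def rayPrimitive (f : ℂ → ℂ) (τ : ℂ) : ℂ := ∫ s in Set.Ioc (0 : ℝ) 1, τ * f ((s : ℂ) * τ)

/-- As for ray integrals, holomorphy comes from domination and the derivative is read off in the
radial direction, where the fundamental theorem of calculus applies. -/
theorem hasDerivAt_rayPrimitive {f : ℂ → ℂ} (hf : DifferentiableOn ℂ f upperHalf)
    (hb : ∀ τ₀ ∈ upperHalf, ∃ C : ℝ, ∀ᶠ τ in 𝓝 τ₀, ∀ s ∈ Set.Ioc (0 : ℝ) 1,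
      ‖f ((s : ℂ) * τ)‖ ≤ C) {τ : ℂ} (hτ : τ ∈ upperHalf) :
    HasDerivAt (rayPrimitive f) (f τ) τ := by
  have hmeas : ∀ τ ∈ upperHalf, ∀ t : ℝ, AEStronglyMeasurable (fun s : ℝ => f ((s : ℂ) * τ))
      (volume.restrict (Set.Ioc (0 : ℝ) t)) := fun τ hτ t =>
    (aestronglyMeasurable_ray hf hτ).mono_measure
      (Measure.restrict_mono Set.Ioc_subset_Ioi_self le_rfl)
  have hdiff : DifferentiableOn ℂ (rayPrimitive f) upperHalf := by
    refine differentiableOn_integral_of_dominated isOpen_upperHalf measurableSet_Ioc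
      (fun τ hτ => (hmeas τ hτ 1).const_mul _)
      (fun s hs => differentiableOn_id.mul (differentiableOn_ray hf hs.1)) ?_
    intro τ₀ hτ₀
    obtain ⟨C, hC⟩ := hb τ₀ hτ₀
    exact ⟨fun _ => (‖τ₀‖ + 1) * C, integrableOn_const (by simp),
      eventually_norm_mul_le (g := fun _ => C) hC⟩
  have hscale : ∀ t : ℝ, 0 < t →
      rayPrimitive f ((t : ℂ) * τ) = ∫ s in (0 : ℝ)..t, τ * f ((s : ℂ) * τ) := by
    intro t ht
    have h := intervalIntegral.smul_integral_comp_mul_left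
      (fun s : ℝ => τ * f ((s : ℂ) * τ)) t (a := 0) (b := 1)
    rw [mul_zero, mul_one] at h
    rw [← h, rayPrimitive, intervalIntegral.integral_of_le zero_le_one, ← integral_smul]
    refine integral_congr_ae (Eventually.of_forall fun s => ?_)
    simp only [Complex.real_smul, Complex.ofReal_mul]
    ring_nf
  have hint : IntervalIntegrable (fun s : ℝ => τ * f ((s : ℂ) * τ)) volume 0 1 := by
    rw [intervalIntegrable_iff_integrableOn_Ioc_of_le zero_le_one]
    obtain ⟨C, hC⟩ := hb τ hτ
    refine Integrable.const_mul (Integrable.mono' (g := fun _ => C)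
      (integrableOn_const (by simp)) (hmeas τ hτ 1) ?_) τ
    exact (ae_restrict_iff' measurableSet_Ioc).2 (Eventually.of_forall hC.self_of_nhds)
  have hcont : ContinuousOn (fun s : ℝ => τ * f ((s : ℂ) * τ)) (Set.Ioi 0) :=
    continuousOn_const.mul (hf.continuousOn.comp (by fun_prop)
      fun s hs => ofReal_mul_mem_upperHalf hs hτ)
  have h1 : HasDerivAt (fun t : ℝ => ∫ s in (0 : ℝ)..t, τ * f ((s : ℂ) * τ))
      (τ * f (((1 : ℝ) : ℂ) * τ)) 1 :=
    intervalIntegral.integral_hasDerivAt_right hint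
      (hcont.stronglyMeasurableAtFilter isOpen_Ioi 1 (by simp))
      (hcont.continuousAt (Ioi_mem_nhds one_pos))
  have h2 : HasDerivAt (fun t : ℝ => rayPrimitive f ((t : ℂ) * τ))
      (τ * f (((1 : ℝ) : ℂ) * τ)) 1 := by
    refine h1.congr_of_eventuallyEq ?_
    filter_upwards [lt_mem_nhds one_pos] with t ht using hscale t ht
  have h3 : HasDerivAt (rayPrimitive f) (deriv (rayPrimitive f) τ) (((1 : ℝ) : ℂ) * τ) := by
    simpa using (hdiff.differentiableAt (upperHalf_mem_nhds hτ)).hasDerivAt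
  have h4 : HasDerivAt (fun t : ℝ => (t : ℂ) * τ) (1 * τ) 1 :=
    (Complex.ofRealCLM.hasDerivAt (x := 1)).mul_const τ
  have h5 := h3.comp (1 : ℝ) h4
  have h5 := h5.unique h2
  have h6 : deriv (rayPrimitive f) τ = f τ := by
    rw [one_mul, mul_comm] at h5
    simpa using mul_left_cancel₀ (ne_zero_of_mem_upperHalf hτ) h5
  exact h6 ▸ (hdiff.differentiableAt (upperHalf_mem_nhds hτ)).hasDerivAt

/-- `∫_0^τ e^{ik(τ-τ')} f(τ') dτ'`. -/
def lateConvolution (k : ℝ) (f : ℂ → ℂ) (τ : ℂ) : ℂ :=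
  ∫ s in Set.Ioc (0 : ℝ) 1, τ * (Complex.exp (Complex.I * k * ((1 - s) * τ)) * f ((s : ℂ) * τ))

/-- `∫_τ^∞ e^{ik(τ'-τ)} f(τ') dτ'`. -/
def earlyConvolution (k : ℝ) (f : ℂ → ℂ) (τ : ℂ) : ℂ :=
  ∫ s in Set.Ioi (1 : ℝ), τ * (Complex.exp (Complex.I * k * ((s - 1) * τ)) * f ((s : ℂ) * τ))

theorem exists_bound_exp_mul {f : ℂ → ℂ} (hf : ExpDecays f) (k : ℝ) :
    ∀ τ₀ ∈ upperHalf, ∃ C : ℝ, ∀ᶠ τ in 𝓝 τ₀, ∀ s ∈ Set.Ioc (0 : ℝ) 1,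
      ‖Complex.exp (Complex.I * k * ((s : ℂ) * τ)) * f ((s : ℂ) * τ)‖ ≤ C := by
  intro τ₀ hτ₀
  obtain ⟨C, c, hC, hc, hb⟩ := hf.ray hτ₀
  obtain ⟨δ, ρ, -, -, hev⟩ := eventually_sector hτ₀
  refine ⟨Real.exp (|k| * (‖τ₀‖ + 1)) * C, ?_⟩
  filter_upwards [hb, hev] with τ hb ⟨h1, _, _, hn⟩ s hs
  rw [norm_mul, norm_exp_I_mul, Complex.im_ofReal_mul]
  have him : 0 < τ.im := h1
  have h3 : τ.im ≤ ‖τ₀‖ + 1 := ((le_abs_self _).trans (Complex.abs_im_le_norm τ)).trans hn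
  gcongr
  · calc -(k * (s * τ.im)) ≤ |k| * (s * τ.im) := by
          rw [← neg_mul]
          exact mul_le_mul_of_nonneg_right (neg_le_abs k) (mul_pos hs.1 him).le
      _ ≤ |k| * (1 * (‖τ₀‖ + 1)) := by
          gcongr
          exact hs.2
      _ = |k| * (‖τ₀‖ + 1) := by ring
  · refine (hb s hs.1).trans (mul_le_of_le_one_right hC (Real.exp_le_one_iff.2 ?_))
    nlinarith [hs.1]

/-- The convolution is `e^{ikτ}` times the primitive of `e^{-ikz} f(z)`. The form of the derivative
is the one used by `Tame.of_hasDerivAt`. -/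
theorem hasDerivAt_lateConvolution {f : ℂ → ℂ} (hf : Tame ExpDecays f) (k : ℝ) {τ : ℂ}
    (hτ : τ ∈ upperHalf) : HasDerivAt (lateConvolution k f)
      (Complex.I * k * lateConvolution k f τ + 1 * f τ) τ := by
  set g : ℂ → ℂ := fun z => Complex.exp (Complex.I * (-k : ℝ) * z) * f z with hg
  have heq : lateConvolution k f =
      fun τ => Complex.exp (Complex.I * k * τ) * rayPrimitive g τ := by
    funext τ
    rw [lateConvolution, rayPrimitive, ← integral_const_mul]
    refine integral_congr_ae (Eventually.of_forall fun s => ?_)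
    have : Complex.I * k * ((1 - s) * τ) =
        Complex.I * k * τ + Complex.I * (-k : ℝ) * (s * τ) := by push_cast; ring
    simp only [this, Complex.exp_add, hg]
    ring
  have hgd : DifferentiableOn ℂ g upperHalf := by
    refine DifferentiableOn.mul (Differentiable.differentiableOn ?_) hf.1
    fun_prop
  have h1 := hasDerivAt_rayPrimitive hgd (exists_bound_exp_mul hf.mem (-k)) hτ
  have h2 : HasDerivAt (fun z : ℂ => Complex.I * k * z) (Complex.I * k) τ := by
    simpa using (hasDerivAt_id τ).const_mul (Complex.I * (k : ℂ))
  rw [heq]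
  refine (h2.cexp.mul h1).congr_deriv ?_
  have h3 : Complex.exp (Complex.I * k * τ) * Complex.exp (Complex.I * (-k : ℝ) * τ) = 1 := by
    rw [← Complex.exp_add, ← Complex.exp_zero]
    congr 1
    push_cast
    ring
  simp only [hg]
  linear_combination f τ * h3

/-- The integral from `τ` to infinity is the full ray integral minus the primitive, and the full ray
integral is a constant because it does not depend on the direction. -/
theorem hasDerivAt_earlyConvolution {f : ℂ → ℂ} (hf : Tame ExpDecays f) {k : ℝ} (hk : 0 ≤ k)
    {τ : ℂ} (hτ : τ ∈ upperHalf) : HasDerivAt (earlyConvolution k f)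
      (-(Complex.I * k) * earlyConvolution k f τ + -1 * f τ) τ := by
  set g : ℂ → ℂ := fun z => Complex.exp (Complex.I * k * z) * f z with hg
  have hgW : ExpDecays g := isLinearClass_expDecays.congr (hf.mem.mul_subexp (subexp_exp hk))
    fun z _ => mul_comm _ _
  have hgd : DifferentiableOn ℂ g upperHalf := by
    refine DifferentiableOn.mul (Differentiable.differentiableOn ?_) hf.1
    fun_prop
  have heq : Set.EqOn (earlyConvolution k f) (fun τ => Complex.exp (-(Complex.I * k * τ)) *
      (-rayIntegral Complex.I g - rayPrimitive g τ)) upperHalf := by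
    intro τ hτ
    have hint : IntegrableOn (fun s : ℝ => τ * g ((s : ℂ) * τ)) (Set.Ioi 0) :=
      (integrableOn_ray hgd hgW.rayDominated hτ).const_mul τ
    have h1 : -rayIntegral Complex.I g - rayPrimitive g τ =
        ∫ s in Set.Ioi (1 : ℝ), τ * g ((s : ℂ) * τ) := by
      rw [rayIntegral_eq hgd hgW.rayDominated (by simp [upperHalf]) hτ, rayIntegral, neg_neg,
        rayPrimitive, ← Set.Ioc_union_Ioi_eq_Ioi zero_le_one, setIntegral_union
        (Set.Ioc_disjoint_Ioi le_rfl) measurableSet_Ioi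
        (hint.mono_set Set.Ioc_subset_Ioi_self)
        (hint.mono_set (Set.Ioi_subset_Ioi zero_le_one)), add_sub_cancel_left]
    beta_reduce
    rw [h1, earlyConvolution, ← integral_const_mul]
    refine integral_congr_ae (Eventually.of_forall fun s => ?_)
    have : Complex.I * k * ((s - 1) * τ) =
        -(Complex.I * k * τ) + Complex.I * k * (s * τ) := by ring
    simp only [this, Complex.exp_add, hg]
    ring
  have h1 := hasDerivAt_rayPrimitive hgd (exists_bound_exp_mul hf.mem k) hτ
  have h2 : HasDerivAt (fun z : ℂ => -(Complex.I * k * z)) (-(Complex.I * k)) τ := by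
    simpa using ((hasDerivAt_id τ).const_mul (Complex.I * (k : ℂ))).fun_neg
  have h4 := heq hτ
  refine ((h2.cexp.mul (h1.const_sub (-rayIntegral Complex.I g))).congr_of_eventuallyEq
    (heq.eventuallyEq_of_mem (upperHalf_mem_nhds hτ))).congr_deriv ?_
  have h3 : Complex.exp (-(Complex.I * k * τ)) * Complex.exp (Complex.I * k * τ) = 1 := by
    rw [← Complex.exp_add, neg_add_cancel, Complex.exp_zero]
  rw [h4]
  simp only [hg]
  linear_combination -f τ * h3

/-- The kernel decays like `e^{-kδ(1-s)‖τ‖}` and `f` like `e^{-cs‖τ‖}`; interpolating in `s` leaves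
at least the rate `c' = min c (kδ)`. Half of it is spent on the factor `‖τ‖` of the measure. -/
theorem expDecays_lateConvolution {f : ℂ → ℂ} (hf : ExpDecays f) {k : ℝ} (hk : 0 < k) :
    ExpDecays (lateConvolution k f) := by
  intro δ hδ
  obtain ⟨C, c, hC, hc, hb⟩ := hf δ hδ
  set c' := min c (k * δ)
  have hc' : 0 < c' := lt_min hc (by positivity)
  refine ⟨2 / c' * C, c' / 2, by positivity, by positivity, fun τ hτ hs => ?_⟩
  have hbd : ∀ s ∈ Set.Ioc (0 : ℝ) 1,
      ‖τ * (Complex.exp (Complex.I * k * ((1 - s) * τ)) * f ((s : ℂ) * τ))‖ ≤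
        ‖τ‖ * (C * Real.exp (-c' * ‖τ‖)) := by
    intro s hs'
    have h1 := hb _ (ofReal_mul_mem_upperHalf hs'.1 hτ) (sector_ofReal_mul hs'.1 hs)
    have h2 : ((1 - s : ℂ) * τ) = ((1 - s : ℝ) : ℂ) * τ := by push_cast; ring
    rw [norm_mul, norm_mul, h2, norm_exp_I_mul, Complex.im_ofReal_mul]
    rw [norm_mul, Complex.norm_real, Real.norm_of_nonneg hs'.1.le] at h1
    refine mul_le_mul_of_nonneg_left ?_ (norm_nonneg _)
    calc Real.exp (-(k * ((1 - s) * τ.im))) * ‖f ((s : ℂ) * τ)‖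
        ≤ Real.exp (-(k * ((1 - s) * τ.im))) * (C * Real.exp (-c * (s * ‖τ‖))) := by gcongr
      _ = C * Real.exp (-(k * ((1 - s) * τ.im)) + -c * (s * ‖τ‖)) := by
          rw [Real.exp_add]; ring
      _ ≤ C * Real.exp (-c' * ‖τ‖) := by
          gcongr
          have e1 : 0 ≤ 1 - s := by linarith [hs'.2]
          have e2 : c' * (s * ‖τ‖) ≤ c * (s * ‖τ‖) :=
            mul_le_mul_of_nonneg_right (min_le_left _ _) (mul_nonneg hs'.1.le (norm_nonneg _))
          have e3 : c' * ((1 - s) * ‖τ‖) ≤ k * δ * ((1 - s) * ‖τ‖) :=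
            mul_le_mul_of_nonneg_right (min_le_right _ _) (mul_nonneg e1 (norm_nonneg _))
          have e4 : k * (1 - s) * (δ * ‖τ‖) ≤ k * (1 - s) * τ.im :=
            mul_le_mul_of_nonneg_left hs (mul_nonneg hk.le e1)
          linarith
  refine (norm_setIntegral_le_of_norm_le_const (by simp) hbd).trans ?_
  have h3 : ‖τ‖ ≤ 2 / c' * Real.exp (c' / 2 * ‖τ‖) := by
    have := Real.add_one_le_exp (c' / 2 * ‖τ‖)
    rw [div_mul_eq_mul_div, le_div_iff₀ hc']
    linarith
  have h4 : Real.exp (-(c' / 2) * ‖τ‖) =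
      Real.exp (c' / 2 * ‖τ‖) * Real.exp (-c' * ‖τ‖) := by
    rw [← Real.exp_add]; ring_nf
  simp only [Real.volume_real_Ioc_of_le zero_le_one, sub_zero, mul_one, h4]
  calc ‖τ‖ * (C * Real.exp (-c' * ‖τ‖))
      ≤ 2 / c' * Real.exp (c' / 2 * ‖τ‖) * (C * Real.exp (-c' * ‖τ‖)) := by gcongr
    _ = _ := by ring

theorem expDecays_earlyConvolution {f : ℂ → ℂ} (hf : ExpDecays f) {k : ℝ} (hk : 0 ≤ k) :
    ExpDecays (earlyConvolution k f) := by
  intro δ hδ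
  obtain ⟨C, c, hC, hc, hb⟩ := hf δ hδ
  -- From `∫_1^∞ ‖τ‖ C e^{-c‖τ‖s} ds = (C/c) e^{-c‖τ‖}`, the kernel having modulus at most `1`.
  refine ⟨C / c, c, by positivity, hc, fun τ hτ hs => ?_⟩
  have hn : 0 < ‖τ‖ := norm_pos_iff.2 (ne_zero_of_mem_upperHalf hτ)
  have him : 0 < τ.im := hτ
  have hcn : -(c * ‖τ‖) < 0 := neg_lt_zero.2 (by positivity)
  have hint : IntegrableOn (fun s : ℝ => ‖τ‖ * C * Real.exp (-(c * ‖τ‖) * s)) (Set.Ioi 1) :=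
    (integrableOn_exp_mul_Ioi hcn 1).const_mul _
  refine (norm_integral_le_of_norm_le hint ((ae_restrict_iff' measurableSet_Ioi).2
    (Eventually.of_forall fun s hs' => ?_))).trans_eq ?_
  · have hs1 : 1 < s := hs'
    have hs0 : 0 < s := one_pos.trans hs1
    have h1 := hb _ (ofReal_mul_mem_upperHalf hs0 hτ) (sector_ofReal_mul hs0 hs)
    have h2 : ((s - 1 : ℂ) * τ) = ((s - 1 : ℝ) : ℂ) * τ := by push_cast; ring
    rw [norm_mul, norm_mul, h2, norm_exp_I_mul, Complex.im_ofReal_mul, mul_assoc]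
    rw [norm_mul, Complex.norm_real, Real.norm_of_nonneg hs0.le] at h1
    refine mul_le_mul_of_nonneg_left ?_ (norm_nonneg _)
    have h3 : Real.exp (-(k * ((s - 1) * τ.im))) ≤ 1 := by
      rw [Real.exp_le_one_iff, neg_nonpos]
      have : 0 ≤ s - 1 := by linarith
      positivity
    refine (mul_le_of_le_one_left (norm_nonneg _) h3).trans (h1.trans_eq ?_)
    ring_nf
  · rw [integral_const_mul, integral_exp_mul_Ioi hcn]
    field_simp

theorem tame_lateConvolution {f : ℂ → ℂ} (hf : Tame ExpDecays f) {k : ℝ} (hk : 0 < k) :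
    Tame ExpDecays (lateConvolution k f) :=
  hf.of_hasDerivAt isLinearClass_expDecays (expDecays_lateConvolution hf.mem hk)
    fun _ hτ => hasDerivAt_lateConvolution hf k hτ

theorem tame_earlyConvolution {f : ℂ → ℂ} (hf : Tame ExpDecays f) {k : ℝ} (hk : 0 ≤ k) :
    Tame ExpDecays (earlyConvolution k f) :=
  hf.of_hasDerivAt isLinearClass_expDecays (expDecays_earlyConvolution hf.mem hk)
    fun _ hτ => hasDerivAt_earlyConvolution hf hk hτ

/-! ### Convergence of diagrams without positive powers of the scale factor -/

/-- No growing exponential survives: the time-ordered part of `G` gives an early and a late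
convolution with kernel `e^{ik|τ-τ'|}`, and the Dirichlet term is `K(k, τ)` times a ray integral
that is constant in `τ`. -/
theorem propagate_eqOn (H : ℝ) {k : ℝ} (hk : 0 < k) (b : ℕ) {S : ℂ → ℂ}
    (hS : Tame ExpDecays S) : Set.EqOn (fun τ =>
      (-((H : ℂ) ^ 2 / (2 * (k : ℂ) ^ 3))) *
        ((1 + (Complex.I * k) * τ) * earlyConvolution k (fun z =>
            ((Complex.I * k) ^ b * (1 - b) + (-(Complex.I * k) ^ b * (Complex.I * k)) * z) * S z) τ +
          (1 + (-Complex.I * k) * τ) * lateConvolution k (fun z =>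
            ((-Complex.I * k) ^ b * (1 - b) + (-Complex.I * k) ^ b * (Complex.I * k) * z) * S z) τ +
          rayIntegral Complex.I (fun z => iteratedDeriv b (bulkToBoundary k) z * S z) *
            bulkToBoundary k τ) +
      ∑ j ∈ Finset.range b, (-1) ^ (b - 1 - j) * bulkJump H k j τ * iteratedDeriv (b - 1 - j) S τ)
    (propagate H k b S) upperHalf := by
  intro τ hτ
  have hKS : Tame ExpDecays fun z => iteratedDeriv b (bulkToBoundary k) z * S z :=
    ((tame_bulkToBoundary hk).iteratedDeriv b).decay_mul hS.subexp
  rw [rayIntegral_eq hKS.1 hKS.mem.rayDominated (by simp [upperHalf]) hτ, rayIntegral, propagate]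
  beta_reduce
  congr 1
  set q : ℂ := (H : ℂ) ^ 2 / (2 * (k : ℂ) ^ 3) with hq
  set Φ : ℝ → ℂ := fun s => τ * (bulkDeriv H k b τ s * S ((s : ℂ) * τ)) with hΦ
  set Z : ℝ → ℂ := fun s =>
    τ * (iteratedDeriv b (bulkToBoundary k) ((s : ℂ) * τ) * S ((s : ℂ) * τ)) with hZ
  have hΦi : IntegrableOn Φ (Set.Ioi 0) := by
    obtain ⟨g, hg, hb⟩ := propagateDominated_of_expDecays H b hk hS.mem τ hτ
    refine Integrable.const_mul (Integrable.mono' hg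
      ((measurable_bulkDeriv H k b τ).aestronglyMeasurable.mul
        (aestronglyMeasurable_ray hS.1 hτ)) ?_) τ
    exact (ae_restrict_iff' measurableSet_Ioi).2 (Eventually.of_forall hb.self_of_nhds)
  have hZi : IntegrableOn Z (Set.Ioi 0) :=
    (integrableOn_ray hKS.1 hKS.mem.rayDominated hτ).const_mul τ
  -- Adding the Dirichlet term back to the integrand leaves the purely time-ordered part, which is
  -- split at `s = 1`.
  set W : ℝ → ℂ := fun s => Φ s + q * bulkToBoundary k τ * Z s with hW
  have hWi : IntegrableOn W (Set.Ioi 0) := hΦi.add (hZi.const_mul _)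
  have h1 : ∫ s in Set.Ioi 0, W s =
      (∫ s in Set.Ioi 0, Φ s) + q * bulkToBoundary k τ * ∫ s in Set.Ioi 0, Z s := by
    rw [← integral_const_mul]
    exact integral_add hΦi (hZi.const_mul _)
  have h2 : ∫ s in Set.Ioi 0, W s = (∫ s in Set.Ioc 0 1, W s) + ∫ s in Set.Ioi 1, W s := by
    rw [← Set.Ioc_union_Ioi_eq_Ioi zero_le_one]
    exact setIntegral_union (Set.Ioc_disjoint_Ioi le_rfl) measurableSet_Ioi
      (hWi.mono_set Set.Ioc_subset_Ioi_self) (hWi.mono_set (Set.Ioi_subset_Ioi zero_le_one))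
  have h3 : ∫ s in Set.Ioi 1, W s = q * (1 + (Complex.I * k) * τ) *
      earlyConvolution k (fun z => ((Complex.I * k) ^ b * (1 - b) +
        (-(Complex.I * k) ^ b * (Complex.I * k)) * z) * S z) τ := by
    rw [earlyConvolution, ← integral_const_mul]
    refine setIntegral_congr_fun measurableSet_Ioi fun s hs => ?_
    have he : Complex.I * k * ((s - 1) * τ) =
        Complex.I * (-k : ℝ) * τ + Complex.I * k * (s * τ) := by push_cast; ring
    simp only [hW, hΦ, hZ, bulkDeriv_of_one_lt H k b τ hs, iteratedDeriv_bulkToBoundary,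
      bulkToBoundary, he, Complex.exp_add, ← hq]
    push_cast
    ring
  have h4 : ∫ s in Set.Ioc 0 1, W s = q * (1 + (-Complex.I * k) * τ) *
      lateConvolution k (fun z => ((-Complex.I * k) ^ b * (1 - b) +
        (-Complex.I * k) ^ b * (Complex.I * k) * z) * S z) τ := by
    rw [lateConvolution, ← integral_const_mul]
    refine setIntegral_congr_fun measurableSet_Ioc fun s hs => ?_
    have he : Complex.I * k * ((1 - s) * τ) =
        Complex.I * k * τ + Complex.I * (-k : ℝ) * (s * τ) := by push_cast; ring
    simp only [hW, hΦ, hZ, bulkDeriv_of_le_one H k b τ hs.2, iteratedDeriv_bulkToBoundary,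
      bulkToBoundary, he, Complex.exp_add, ← hq]
    push_cast
    ring
  rw [h2, h3, h4] at h1
  linear_combination -h1

theorem tame_propagate (H : ℝ) {k : ℝ} (hk : 0 < k) (b : ℕ) {S : ℂ → ℂ}
    (hS : Tame ExpDecays S) : Tame ExpDecays (propagate H k b S) := by
  have hL := isLinearClass_expDecays
  refine Tame.congr hL (Tame.add hL (Tame.const_mul hL _ (Tame.add hL (Tame.add hL
    ((Tame.affine _ _).mul_decay (tame_earlyConvolution ((Tame.affine _ _).mul_decay hS) hk.le))
    ((Tame.affine _ _).mul_decay (tame_lateConvolution ((Tame.affine _ _).mul_decay hS) hk)))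
    ((tame_bulkToBoundary hk).const_mul hL _))) ?_) (propagate_eqOn H hk b hS)
  have h : ∀ s : Finset ℕ, Tame ExpDecays fun τ => ∑ j ∈ s,
      (-1) ^ (b - 1 - j) * bulkJump H k j τ * iteratedDeriv (b - 1 - j) S τ := by
    intro s
    induction s using Finset.induction_on with
    | empty =>
      simpa using hS.const_mul hL 0
    | insert a s ha ih =>
      simp_rw [Finset.sum_insert ha]
      exact Tame.add hL (Tame.mul_decay ((tame_bulkJump H k a).const_mul isLinearClass_subexp _)
        (hS.iteratedDeriv _)) ih
  exact h _

namespace Branch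

variable {E : ℕ}

/-- A vertex with no outgoing branch would send zero momentum through its internal line. The branch
found here makes the source decay. -/
theorem exists_leg_of_generic {N : ℕ} {O : LocalOperator (N + 1)} {legs : Fin N → Branch E}
    {k : Fin E → Vec3} (h : (vertex N O legs).Generic k) : Nonempty (Fin N) := by
  rcases N with _ | N
  · exact absurd (by simp) h.1
  · exact ⟨0⟩

theorem tame_source {H : ℝ} {k : Fin E → Vec3} {N : ℕ} {O : LocalOperator (N + 1)}
    {legs : Fin N → Branch E} (hO : O.scalePower ≤ 0) [Nonempty (Fin N)]
    (h : ∀ i, Tame ExpDecays ((legs i).field H k)) : Tame ExpDecays (source H k O legs) := by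
  have i₀ : Fin N := Classical.arbitrary _
  have h1 : Tame ExpDecays fun τ => ∏ i, iteratedDeriv (O.timeDeriv i.succ)
      ((legs i).field H k) τ :=
    Tame.prod_decay (fun i => ((h i).iteratedDeriv (O.timeDeriv i.succ)).subexp) i₀
      ((h i₀).iteratedDeriv _)
  exact (tame_vertexFactor H hO _).mul_decay h1

theorem tame_field (H : ℝ) {k : Fin E → Vec3} (b : Branch E) (hg : b.Generic k)
    (hp : b.NonposPowers) : Tame ExpDecays (b.field H k) ∧ b.Converges H k := by
  induction b with
  | external e => exact ⟨tame_bulkToBoundary (norm_pos_iff.2 hg), trivial⟩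
  | vertex N O legs ih =>
    have := exists_leg_of_generic hg
    have ih := fun i => ih i (hg.2 i) (hp.2 i)
    have hS : Tame ExpDecays (source H k O legs) := tame_source hp.1 fun i => (ih i).1
    have hk : 0 < ‖∑ i, (legs i).momentum k‖ := norm_pos_iff.2 hg.1
    have hd := propagateDominated_of_expDecays H (O.timeDeriv 0) hk hS.mem
    rw [field_vertex]
    exact ⟨tame_propagate H hk _ hS, fun i => (ih i).2, hd⟩

end Branch

/-- Excludes a root without legs, where nothing would decay. -/
theorem LocalOperator.scalePower_of_isEmpty (O : LocalOperator 0) : O.scalePower = 4 := by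
  have hm : O.m = 0 := by
    by_contra h
    exact (O.contr ⟨0, Nat.pos_of_ne_zero h⟩).1.elim0
  rcases he : O.eps with _ | t
  · simp [scalePower, he, hm, n]
  · exact (t 0).elim0

theorem TreeDiagram.converges_of_nonposPowers {E : ℕ} (H : ℝ) {D : TreeDiagram E}
    {k : Fin E → Vec3} (hg : D.Generic k) (hp : D.NonposPowers) : D.Converges H k := by
  obtain ⟨N, O, legs, each⟩ := D
  rcases N with _ | N
  · have := hp.1
    simp [LocalOperator.scalePower_of_isEmpty] at this
  · have h := fun i => Branch.tame_field H (legs i) (hg i) (hp.2 i)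
    have h1 : Tame ExpDecays fun τ => ∏ i, iteratedDeriv (O.timeDeriv i)
        ((legs i).field H k) τ :=
      Tame.prod_decay (fun i => ((h i).1.iteratedDeriv (O.timeDeriv i)).subexp) 0
        ((h 0).1.iteratedDeriv _)
    exact ⟨fun i => (h i).2, ((tame_vertexFactor H hp.1 _).mul_decay h1).mem.rayDominated⟩

/-! ### Contact diagrams -/

theorem I_mem_upperHalf : Complex.I ∈ upperHalf := by simp [upperHalf]

/-- The time-dependent part of a contact diagram with external energies `κ`. -/
def contactCore {N : ℕ} (H : ℝ) (O : LocalOperator N) (κ : Fin N → ℝ) (τ : ℂ) : ℂ :=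
  scaleFactor H τ ^ O.scalePower * ∏ i, iteratedDeriv (O.timeDeriv i) (bulkToBoundary (κ i)) τ

namespace LocalOperator

variable {N : ℕ} {O : LocalOperator N}

theorem scalePower_of_isOdd (hO : O.IsOdd) : O.scalePower = 1 - 2 * (O.m : ℤ) - (O.n : ℤ) := by
  obtain ⟨t, ht⟩ := Option.isSome_iff_exists.1 hO
  simp [scalePower, ht]

theorem scalePower_nonpos (hO : O.IsOdd) (h : 0 < 2 * O.m + O.n) : O.scalePower ≤ 0 := by
  rw [scalePower_of_isOdd hO]
  omega

/-- A determinant with a zero row vanishes. So a P-odd contact diagram is either zero or has a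
decaying leg, which covers configurations with zero momenta. -/
theorem exists_ne_zero_of_spatial_ne_zero (hO : O.IsOdd) {p : Fin N → Vec3}
    (h : O.spatial p ≠ 0) : ∃ i, p i ≠ 0 := by
  obtain ⟨t, ht⟩ := Option.isSome_iff_exists.1 hO
  refine ⟨t 0, fun h0 => h ?_⟩
  have : Matrix.det (Matrix.of fun (a i : Fin 3) => p (t a) i) = 0 :=
    Matrix.det_eq_zero_of_row_eq_zero 0 fun j => by simp [h0]
  simp [spatial, ht, this]

end LocalOperator

theorem tame_contactCore {N : ℕ} (H : ℝ) {O : LocalOperator N} (hO : O.scalePower ≤ 0)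
    {κ : Fin N → ℝ} (hκ : ∀ i, 0 ≤ κ i) (h : ∃ i, 0 < κ i) :
    Tame ExpDecays (contactCore H O κ) := by
  obtain ⟨i, hi⟩ := h
  have h1 : Tame ExpDecays fun τ =>
      ∏ i, iteratedDeriv (O.timeDeriv i) (bulkToBoundary (κ i)) τ :=
    Tame.prod_decay (fun i => (tame_subexp_bulkToBoundary (hκ i)).iteratedDeriv (O.timeDeriv i)) i
      ((tame_bulkToBoundary hi).iteratedDeriv _)
  exact (tame_scaleFactor_zpow H hO).mul_decay h1

/-- The exponent is `1 + (1 - 2m - n) - n`, which is even. P-oddness is essential: a P-even operator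
would give an odd exponent. -/
theorem isPhase_rayIntegral_contactCore {N : ℕ} (H : ℝ) {O : LocalOperator N} (hO : O.IsOdd)
    (κ : Fin N → ℝ) : IsPhase 0 (rayIntegral Complex.I (contactCore H O κ)) := by
  refine (IsPhase.integral measurableSet_Ioi fun s hs => ?_).neg
  refine (IsPhase.I.mul (((isPhase_scaleFactor H s).zpow O.scalePower).mul
    (IsPhase.prod fun i _ =>
      isPhase_iteratedDeriv_bulkToBoundary (κ i) (O.timeDeriv i) hs))).congr ?_
  rw [LocalOperator.scalePower_of_isOdd hO, LocalOperator.n]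
  refine ⟨O.m + ∑ i, (O.timeDeriv i : ℤ) - 1, ?_⟩
  simp only [Finset.sum_neg_distrib]
  push_cast
  ring

namespace TreeDiagram

variable {N : ℕ}

theorem integrand_contact (H : ℝ) (O : LocalOperator N) (σ : Equiv.Perm (Fin N))
    (k : Fin N → Vec3) (τ : ℂ) : (contact O σ).integrand H k τ =
      Complex.I * O.coupling * O.spatial (fun i => k (σ i)) *
        contactCore H O (fun i => ‖k (σ i)‖) τ :=
  mul_assoc _ _ _

theorem regulated_contact (H : ℝ) (O : LocalOperator N) (σ : Equiv.Perm (Fin N))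
    (k : Fin N → Vec3) (ω : ℂ) : (contact O σ).regulated H k ω =
      Complex.I * O.coupling * O.spatial (fun i => k (σ i)) *
        rayIntegral ω (contactCore H O fun i => ‖k (σ i)‖) := by
  rw [regulated, rayIntegral, rayIntegral, mul_neg, ← integral_const_mul]
  congr 1
  refine integral_congr_ae (Eventually.of_forall fun s => ?_)
  simp only [integrand_contact]
  ring

theorem regulated_contact_contour (H : ℝ) {O : LocalOperator N} (hO : O.IsOdd)
    (h : 0 < 2 * O.m + O.n) (σ : Equiv.Perm (Fin N)) (k : Fin N → Vec3) {ε : ℝ} (hε : 0 < ε) :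
    (contact O σ).regulated H k (contour ε) = (contact O σ).regulated H k Complex.I := by
  rw [regulated_contact, regulated_contact]
  by_cases hs : O.spatial (fun i => k (σ i)) = 0
  · simp [hs]
  · obtain ⟨i, hi⟩ := O.exists_ne_zero_of_spatial_ne_zero hO hs
    have hT := tame_contactCore H (O.scalePower_nonpos hO h)
      (κ := fun i => ‖k (σ i)‖) (fun _ => norm_nonneg _) ⟨i, norm_pos_iff.2 hi⟩
    rw [rayIntegral_eq hT.1 hT.mem.rayDominated (contour_mem_upperHalf hε)
      I_mem_upperHalf]

theorem numOdd_contact {O : LocalOperator N} (hO : O.IsOdd) (σ : Equiv.Perm (Fin N)) :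
    (contact O σ).numOdd = 1 := by
  have : O.eps.isSome = true := hO
  simp [numOdd, contact, this, Branch.numOdd]

theorem psi_contact (H : ℝ) {O : LocalOperator N} (hO : O.IsOdd) (h : 0 < 2 * O.m + O.n)
    (σ : Equiv.Perm (Fin N)) (k : Fin N → Vec3) :
    (contact O σ).psi H k = (contact O σ).regulated H k Complex.I :=
  (tendsto_psi fun _ hε => regulated_contact_contour H hO h σ k hε).2

theorem psi_contact_neg (H : ℝ) {O : LocalOperator N} (hO : O.IsOdd) (h : 0 < 2 * O.m + O.n)
    (σ : Equiv.Perm (Fin N)) (k : Fin N → Vec3) :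
    (contact O σ).psi H (-k) = -(contact O σ).psi H k := by
  rw [psi_contact H hO h, psi_contact H hO h, regulated_neg, numOdd_contact hO]
  ring

theorem im_psi_contact {H : ℝ} (hH : 0 < H) {O : LocalOperator N} (hO : O.IsOdd)
    (h : 0 < 2 * O.m + O.n) (σ : Equiv.Perm (Fin N)) (k : Fin N → Vec3) :
    ((contact O σ).psi H k).im = 0 := by
  rw [psi_contact H hO h]
  exact (isPhase_regulated_I hH (contact O σ) (k := k) fun _ => trivial).im_eq_zero

theorem converges_contact (H : ℝ) {O : LocalOperator N} (hO : O.IsOdd) (h : 0 < 2 * O.m + O.n)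
    (σ : Equiv.Perm (Fin N)) {k : Fin N → Vec3} (hk : ∀ i, k i ≠ 0) :
    (contact O σ).Converges H k :=
  converges_of_nonposPowers H (fun i => hk (σ i))
    ⟨O.scalePower_nonpos hO h, fun _ => trivial⟩

end TreeDiagram

section contactPsi

variable {N : ℕ}

theorem contactPsi_neg (H : ℝ) {O : LocalOperator N} (hO : O.IsOdd) (h : 0 < 2 * O.m + O.n)
    (k : Fin N → Vec3) : contactPsi H O (-k) = -contactPsi H O k := by
  simp only [contactPsi, TreeDiagram.psi_contact_neg H hO h, Finset.sum_neg_distrib]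

theorem im_contactPsi {H : ℝ} (hH : 0 < H) {O : LocalOperator N} (hO : O.IsOdd)
    (h : 0 < 2 * O.m + O.n) (k : Fin N → Vec3) : (contactPsi H O k).im = 0 := by
  rw [contactPsi, Complex.im_sum]
  exact Finset.sum_eq_zero fun σ _ => TreeDiagram.im_psi_contact hH hO h σ k

end contactPsi

/-! ### In-in correlators -/

-- Schwarz reflection: conjugating the time exchanges the time-ordered and the anti-time-ordered
-- integrands.
open ComplexConjugate in
theorem contactCore_conj {N : ℕ} (H : ℝ) (O : LocalOperator N) (κ : Fin N → ℝ) (τ : ℂ) :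
    contactCore H O (fun i => -κ i) (conj τ) = conj (contactCore H O κ τ) := by
  rw [contactCore, contactCore, map_mul, map_prod, map_zpow₀]
  congr 1
  · simp [scaleFactor]
  · refine Finset.prod_congr rfl fun i _ => ?_
    simp only [iteratedDeriv_bulkToBoundary, map_mul, map_pow, map_sub, map_one, map_natCast,
      Complex.conj_I, Complex.conj_ofReal, ← Complex.exp_conj]
    push_cast
    ring_nf

open ComplexConjugate in
theorem rayIntegral_contactCore_conj {N : ℕ} (H : ℝ) (O : LocalOperator N) (κ : Fin N → ℝ)
    (ω : ℂ) : rayIntegral (conj ω) (contactCore H O fun i => -κ i) =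
      conj (rayIntegral ω (contactCore H O κ)) := by
  rw [rayIntegral, rayIntegral, map_neg, ← integral_conj]
  congr 1
  refine integral_congr_ae (Eventually.of_forall fun s => ?_)
  simp only [map_mul, ← contactCore_conj, Complex.conj_ofReal]

/-- The time-ordered and the anti-time-ordered contact diagrams cancel, for any regulator. -/
theorem inInContact_eq_zero {N : ℕ} (H : ℝ) {O : LocalOperator N} (hO : O.IsOdd)
    (h : 0 < 2 * O.m + O.n) (k : Fin N → Vec3) {ε : ℝ} (hε : 0 < ε) :
    inInContact H O k ε = 0 := by
  rw [inInContact]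
  refine mul_eq_zero_of_right _ (Finset.sum_eq_zero fun σ _ => ?_)
  by_cases hs : O.spatial (fun i => k (σ i)) = 0
  · simp [hs]
  obtain ⟨i, hi⟩ := O.exists_ne_zero_of_spatial_ne_zero hO hs
  have hT := tame_contactCore H (O.scalePower_nonpos hO h)
    (κ := fun i => ‖k (σ i)‖) (fun _ => norm_nonneg _) ⟨i, norm_pos_iff.2 hi⟩
  have h1 : rayIntegral (contour ε) (contactCore H O fun i => ‖k (σ i)‖) =
      rayIntegral Complex.I (contactCore H O fun i => ‖k (σ i)‖) :=
    rayIntegral_eq hT.1 hT.mem.rayDominated (contour_mem_upperHalf hε) I_mem_upperHalf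
  have hc : contour (-ε) = (starRingEnd ℂ) (contour ε) := by
    simp [contour, Complex.ext_iff]
  have h2 := rayIntegral_contactCore_conj H O (fun i => ‖k (σ i)‖) (contour ε)
  -- The two time integrals are conjugate and real, hence equal; the vertex factors `i` and `-i`
  -- then cancel.
  rw [h1, Complex.conj_eq_iff_im.2 (isPhase_rayIntegral_contactCore H hO _).im_eq_zero, ← hc] at h2
  refine mul_eq_zero_of_right _ ?_
  change Complex.I * rayIntegral (contour ε) (contactCore H O fun i => ‖k (σ i)‖) +
    -Complex.I * rayIntegral (contour (-ε)) (contactCore H O fun i => -‖k (σ i)‖) = 0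
  rw [h1, h2]
  ring

theorem tendsto_inInContact {N : ℕ} (H : ℝ) {O : LocalOperator N} (hO : O.IsOdd)
    (h : 0 < 2 * O.m + O.n) (k : Fin N → Vec3) :
    Tendsto (fun ε : ℝ => inInContact H O k ε) (𝓝[>] 0) (𝓝 0) := by
  refine tendsto_const_nhds.congr' ?_
  filter_upwards [self_mem_nhdsWithin] with ε hε using (inInContact_eq_zero H hO h k hε).symm

/-! ### Size and continuity of contact diagrams -/

theorem continuous_spatial {N : ℕ} (O : LocalOperator N) : Continuous O.spatial := by
  unfold LocalOperator.spatial
  refine Continuous.mul ?_ ?_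
  · rcases O.eps with _ | t
    · exact continuous_const
    · refine continuous_const.mul (Complex.continuous_ofReal.comp (Continuous.matrix_det ?_))
      refine continuous_pi fun a => continuous_pi fun i => ?_
      simp only [Matrix.of_apply]
      fun_prop
  · fun_prop

/-- The value on the imaginary direction replaces the limit in `psi` by an integral with a jointly
continuous integrand. -/
theorem measurable_contactPsi (H : ℝ) {N : ℕ} {O : LocalOperator N} (hO : O.IsOdd)
    (h : 0 < 2 * O.m + O.n) : Measurable (contactPsi H O) := by
  unfold contactPsi
  refine Finset.measurable_fun_sum _ fun σ _ => ?_
  have hψ : (TreeDiagram.contact O σ).psi H = fun k => Complex.I * O.coupling *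
      O.spatial (fun i => k (σ i)) *
        rayIntegral Complex.I (contactCore H O fun i => ‖k (σ i)‖) :=
    funext fun k => (TreeDiagram.psi_contact H hO h σ k).trans
      (TreeDiagram.regulated_contact H O σ k Complex.I)
  rw [hψ]
  unfold rayIntegral
  refine Measurable.mul ?_ (Measurable.neg ?_)
  · refine Continuous.measurable (continuous_const.mul ((continuous_spatial O).comp ?_))
    fun_prop
  · refine (StronglyMeasurable.integral_prod_right (Continuous.stronglyMeasurable ?_)).measurable
    obtain ⟨q, hq⟩ : ∃ q : ℕ, O.scalePower = -q :=
      ⟨O.scalePower.natAbs, by have := O.scalePower_nonpos hO h; omega⟩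
    simp only [contactCore, hq, scaleFactor_zpow_neg, iteratedDeriv_bulkToBoundary]
    unfold Function.uncurry
    fun_prop

theorem norm_spatial_le {N : ℕ} {O : LocalOperator N} (hO : O.IsOdd) {p : Fin N → Vec3} {K : ℝ}
    (hK : ∀ i, ‖p i‖ ≤ K) : ‖O.spatial p‖ ≤ 6 * K ^ (3 + 2 * O.m) := by
  obtain ⟨t, ht⟩ := Option.isSome_iff_exists.1 hO
  have hK0 : 0 ≤ K := (norm_nonneg _).trans (hK (t 0))
  -- The `6 = 3!` counts the terms of the determinant.
  have h1 : |Matrix.det (Matrix.of fun (a i : Fin 3) => p (t a) i)| ≤ 6 * K ^ 3 := by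
    have := Matrix.det_le (A := Matrix.of fun (a i : Fin 3) => p (t a) i)
      (abv := AbsoluteValue.abs) (x := K) fun a i =>
        (PiLp.norm_apply_le (p (t a)) i).trans (hK (t a))
    simpa [Nat.factorial] using this
  have h2 : |∏ l, inner ℝ (p (O.contr l).1) (p (O.contr l).2)| ≤ (K * K) ^ O.m := by
    rw [Finset.abs_prod]
    refine (Finset.prod_le_prod (fun _ _ => abs_nonneg _) fun l _ =>
      (abs_real_inner_le_norm _ _).trans
        (mul_le_mul (hK _) (hK _) (norm_nonneg _) hK0)).trans_eq ?_
    simp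
  simp only [LocalOperator.spatial, ht, norm_mul, norm_pow, Complex.norm_I, one_pow, one_mul,
    Complex.norm_real, Real.norm_eq_abs]
  calc _ ≤ 6 * K ^ 3 * (K * K) ^ O.m := mul_le_mul h1 h2 (abs_nonneg _) (by positivity)
    _ = 6 * K ^ (3 + 2 * O.m) := by rw [pow_add, pow_mul]; ring

/-- Half of the exponential absorbs the linear polynomial, through `1 + y ≤ e^y` with `y = kx/2`. -/
theorem norm_iteratedDeriv_bulkToBoundary_le {k x : ℝ} (hk : 0 ≤ k) (hx : 0 < x) (n : ℕ) :
    ‖iteratedDeriv n (bulkToBoundary k) (x * Complex.I)‖ ≤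
      2 * (1 + n) * k ^ n * Real.exp (-(k * x / 2)) := by
  have h1 : (1 - n - Complex.I * k * (x * Complex.I) : ℂ) = ((1 - n + k * x : ℝ) : ℂ) := by
    push_cast
    linear_combination -(k * x : ℂ) * Complex.I_mul_I
  have hkx : 0 ≤ k * x := by positivity
  have hn : (0 : ℝ) ≤ n := n.cast_nonneg
  rw [iteratedDeriv_bulkToBoundary]
  simp only [norm_mul, norm_exp_I_mul, h1, norm_pow, Complex.norm_I, one_mul, Complex.norm_real,
    Real.norm_of_nonneg hk, Complex.im_ofReal_mul, Complex.I_im, mul_one]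
  have h2 : ‖1 - (n : ℝ) + k * x‖ ≤ 2 * (1 + n) * (k * x / 2 + 1) := by
    rw [Real.norm_eq_abs, abs_le]
    constructor <;> nlinarith [mul_nonneg hn hkx]
  have h3 : Real.exp (-(k * x / 2)) = Real.exp (k * x / 2) * Real.exp (-(k * x)) := by
    rw [← Real.exp_add]; ring_nf
  rw [h3]
  calc k ^ n * ‖1 - (n : ℝ) + k * x‖ * Real.exp (-(k * x))
      ≤ k ^ n * (2 * (1 + n) * Real.exp (k * x / 2)) * Real.exp (-(k * x)) := by
        gcongr
        refine h2.trans ?_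
        gcongr
        exact Real.add_one_le_exp _
    _ = _ := by ring

/-- With total energy `K` and `a^{-q}`, the integrand is of size `K^n s^q e^{-Ks/2}`, so the
integral scales as `K^{n-q-1} = K^{-2m}`. -/
theorem norm_rayIntegral_contactCore_le (H : ℝ) {N : ℕ} {O : LocalOperator N} (hO : O.IsOdd)
    (h : 0 < 2 * O.m + O.n) : ∃ C : ℝ, 0 ≤ C ∧ ∀ κ : Fin N → ℝ, (∀ i, 0 ≤ κ i) →
      0 < ∑ i, κ i → (∑ i, κ i) ^ (2 * O.m) *
        ‖rayIntegral Complex.I (contactCore H O κ)‖ ≤ C := by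
  obtain ⟨q, hq⟩ : ∃ q : ℕ, O.scalePower = -q :=
    ⟨O.scalePower.natAbs, by have := O.scalePower_nonpos hO h; omega⟩
  have hq' : 2 * O.m + O.n = q + 1 := by
    have := O.scalePower_of_isOdd hO
    omega
  set A : ℝ := ∏ i, (2 * (1 + (O.timeDeriv i : ℝ))) with hA
  have hA0 : 0 ≤ A := Finset.prod_nonneg fun i _ => by positivity
  -- `A` collects the constants of the legs, `4^q q!` trades `(Ks)^q` for `e^{Ks/4}`, and the last
  -- `4` is from `∫ e^{-Ks/4} ds = 4/K`.
  refine ⟨|H| ^ q * A * (4 ^ q * q.factorial) * 4, by positivity, fun κ hκ hK => ?_⟩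
  set K := ∑ i, κ i with hKdef
  have hle : ∀ i, κ i ≤ K := fun i =>
    Finset.single_le_sum (fun j _ => hκ j) (Finset.mem_univ i)
  have hcore : ∀ s : ℝ, 0 < s → K ^ (2 * O.m) * ‖contactCore H O κ (s * Complex.I)‖ ≤
      |H| ^ q * A * (4 ^ q * q.factorial) * K * Real.exp (-(K / 4) * s) := by
    intro s hs
    have e1 : ∏ i, ‖iteratedDeriv (O.timeDeriv i) (bulkToBoundary (κ i)) (s * Complex.I)‖ ≤
        A * K ^ O.n * Real.exp (-(K * s / 2)) := by
      calc _ ≤ ∏ i, (2 * (1 + (O.timeDeriv i : ℝ)) * K ^ O.timeDeriv i *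
            Real.exp (-(κ i * s / 2))) := by
            refine Finset.prod_le_prod (fun _ _ => norm_nonneg _) fun i _ => ?_
            refine (norm_iteratedDeriv_bulkToBoundary_le (hκ i) hs _).trans ?_
            have := hκ i
            have := hle i
            gcongr
        _ = A * K ^ O.n * Real.exp (-(K * s / 2)) := by
            rw [Finset.prod_mul_distrib, Finset.prod_mul_distrib, ← Real.exp_sum,
              Finset.prod_pow_eq_pow_sum, LocalOperator.n, hKdef, Finset.sum_neg_distrib,
              ← Finset.sum_div, ← Finset.sum_mul]
    have e2 : (K * s) ^ q * Real.exp (-(K * s / 2)) ≤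
        4 ^ q * q.factorial * Real.exp (-(K / 4) * s) := by
      have := Real.pow_div_factorial_le_exp (K * s / 4) (by positivity) q
      rw [div_le_iff₀ (by positivity), div_pow, div_le_iff₀ (by positivity)] at this
      calc (K * s) ^ q * Real.exp (-(K * s / 2))
          ≤ Real.exp (K * s / 4) * q.factorial * 4 ^ q * Real.exp (-(K * s / 2)) := by gcongr
        _ = 4 ^ q * q.factorial * (Real.exp (K * s / 4) * Real.exp (-(K * s / 2))) := by ring
        _ = _ := by rw [← Real.exp_add]; ring_nf
    rw [contactCore, hq, scaleFactor_zpow_neg, norm_mul, norm_pow, norm_mul, norm_mul, norm_neg,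
      Complex.norm_I, mul_one, Complex.norm_real, Complex.norm_real, Real.norm_eq_abs,
      Real.norm_of_nonneg hs.le, norm_prod]
    calc _ ≤ K ^ (2 * O.m) * ((|H| * s) ^ q * (A * K ^ O.n * Real.exp (-(K * s / 2)))) := by
          gcongr
      _ = |H| ^ q * A * (K ^ (2 * O.m + O.n) * s ^ q * Real.exp (-(K * s / 2))) := by
          rw [mul_pow, pow_add]; ring
      _ = |H| ^ q * A * K * ((K * s) ^ q * Real.exp (-(K * s / 2))) := by
          rw [hq', mul_pow, pow_succ]; ring
      _ ≤ |H| ^ q * A * K * (4 ^ q * q.factorial * Real.exp (-(K / 4) * s)) := by gcongr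
      _ = _ := by ring
  have hneg : -(K / 4) < 0 := by linarith
  have hKm : 0 < K ^ (2 * O.m) := by positivity
  rw [rayIntegral, norm_neg, ← le_div_iff₀' hKm]
  refine (norm_integral_le_of_norm_le (g := fun s => |H| ^ q * A * (4 ^ q * q.factorial) * K /
    K ^ (2 * O.m) * Real.exp (-(K / 4) * s)) ((integrableOn_exp_mul_Ioi hneg 0).const_mul _)
    ((ae_restrict_iff' measurableSet_Ioi).2 (Eventually.of_forall fun s hs => ?_))).trans_eq ?_
  · rw [norm_mul, Complex.norm_I, one_mul, div_mul_eq_mul_div, le_div_iff₀' hKm]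
    exact hcore s hs
  · rw [integral_const_mul, integral_exp_mul_Ioi hneg, mul_zero, Real.exp_zero]
    field_simp

/-- Contact diagrams are bounded by their scaling dimension. -/
theorem exists_norm_contactPsi_le (H : ℝ) {N : ℕ} {O : LocalOperator N} (hO : O.IsOdd)
    (h : 0 < 2 * O.m + O.n) : ∃ C : ℝ, 0 ≤ C ∧ ∀ k : Fin N → Vec3,
      ‖contactPsi H O k‖ ≤ C * (∑ i, ‖k i‖) ^ 3 := by
  obtain ⟨C, hC, hb⟩ := norm_rayIntegral_contactCore_le H hO h
  refine ⟨∑ _σ : Equiv.Perm (Fin N), |O.coupling| * 6 * C, by positivity, fun k => ?_⟩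
  rw [contactPsi, Finset.sum_mul]
  refine (norm_sum_le _ _).trans (Finset.sum_le_sum fun σ _ => ?_)
  rw [TreeDiagram.psi_contact H hO h, TreeDiagram.regulated_contact]
  have hsum : ∑ i, ‖k (σ i)‖ = ∑ i, ‖k i‖ := Equiv.sum_comp σ fun i => ‖k i‖
  have hK0 : 0 ≤ ∑ i, ‖k i‖ := Finset.sum_nonneg fun _ _ => norm_nonneg _
  have hsp := norm_spatial_le hO (p := fun i => k (σ i)) (K := ∑ i, ‖k i‖) fun i =>
    Finset.single_le_sum (f := fun i => ‖k i‖) (fun _ _ => norm_nonneg _) (Finset.mem_univ (σ i))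
  rw [norm_mul, norm_mul, norm_mul, Complex.norm_I, one_mul, Complex.norm_real, Real.norm_eq_abs]
  rcases hK0.eq_or_lt with hK | hK
  -- At zero total energy the time integral is not controlled, but the spatial factor vanishes.
  · rw [← hK, zero_pow (by omega), mul_zero] at hsp
    rw [le_antisymm hsp (norm_nonneg _), mul_zero, zero_mul]
    positivity
  · have hb := hb (fun i => ‖k (σ i)‖) (fun _ => norm_nonneg _) (hsum ▸ hK)
    rw [hsum] at hb
    set R := ‖rayIntegral Complex.I (contactCore H O fun i => ‖k (σ i)‖)‖
    calc |O.coupling| * ‖O.spatial fun i => k (σ i)‖ * R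
        ≤ |O.coupling| * (6 * (∑ i, ‖k i‖) ^ (3 + 2 * O.m)) * R := by gcongr
      _ = |O.coupling| * 6 * (∑ i, ‖k i‖) ^ 3 * ((∑ i, ‖k i‖) ^ (2 * O.m) * R) := by
          rw [pow_add]; ring
      _ ≤ |O.coupling| * 6 * (∑ i, ‖k i‖) ^ 3 * C := by gcongr
      _ = _ := by ring

/-! ### Pure phases -/

section Mode

open ComplexConjugate in
theorem mode_neg (φ : 𝓢(Vec3, ℝ)) (k : Vec3) : mode φ (-k) = conj (mode φ k) := by
  rw [mode, mode, ← integral_conj]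
  refine integral_congr_ae (Eventually.of_forall fun x => ?_)
  simp [← Complex.exp_conj]

open FourierTransform in
/-- The Fourier modes of a Schwartz function form a Schwartz function. -/
theorem exists_schwartz_eq_mode (φ : 𝓢(Vec3, ℝ)) : ∃ g : 𝓢(Vec3, ℂ), ⇑g = mode φ := by
  -- The Fourier transform `𝓕` has `2π` in its exponent and `mode` does not; rescaling the momentum
  -- by `1/(2π)` matches them.
  have hpi : (2 * Real.pi)⁻¹ ≠ 0 := by positivity
  refine ⟨SchwartzMap.compCLMOfContinuousLinearEquiv ℂ
    (ContinuousLinearEquiv.smulLeft (Units.mk0 _ hpi) : Vec3 ≃L[ℝ] Vec3)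
    (𝓕 (φ.postcompCLM Complex.ofRealCLM)), ?_⟩
  funext k
  rw [SchwartzMap.compCLMOfContinuousLinearEquiv_apply, Function.comp_apply,
    SchwartzMap.fourier_coe, Real.fourier_eq', mode]
  refine integral_congr_ae (Eventually.of_forall fun x => ?_)
  have : (inner ℝ x ((2 * Real.pi)⁻¹ • k) : ℝ) = (2 * Real.pi)⁻¹ * inner ℝ k x := by
    rw [real_inner_smul_right, real_inner_comm]
  change Complex.exp (((-2 * Real.pi * inner ℝ x ((2 * Real.pi)⁻¹ • k) : ℝ) : ℂ) * Complex.I) *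
    (φ x : ℂ) = _
  have h2 : -2 * Real.pi * ((2 * Real.pi)⁻¹ * inner ℝ k x) = -inner ℝ k x := by
    field_simp
  rw [this, h2]
  congr 2
  push_cast
  ring

end Mode

theorem conserve_neg {M : ℕ} (q : Fin M → Vec3) : conserve (-q) = -conserve q := by
  funext i
  refine Fin.cases ?_ (fun i => ?_) i <;> simp [conserve]

theorem continuous_conserve {M : ℕ} : Continuous (conserve (M := M)) := by
  unfold conserve
  refine continuous_pi fun i => ?_
  refine Fin.cases ?_ (fun i => ?_) i
  · simp only [Fin.cons_zero]; fun_prop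
  · simp only [Fin.cons_succ]; fun_prop

open ComplexConjugate in
theorem phaseIntegrand_neg {M : ℕ} {ψ : (Fin (M + 1) → Vec3) → ℂ} (φ : 𝓢(Vec3, ℝ))
    {q : Fin M → Vec3} (him : (ψ (conserve q)).im = 0)
    (hodd : ψ (-conserve q) = -ψ (conserve q)) :
    phaseIntegrand ψ φ (-q) = -conj (phaseIntegrand ψ φ q) := by
  simp only [phaseIntegrand, conserve_neg, hodd, Pi.neg_apply, mode_neg, map_mul, map_inv₀,
    Complex.conj_ofReal, map_prod, Complex.conj_eq_iff_im.2 him]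
  ring

/-- A real and parity-odd coefficient is a pure phase. -/
theorem isPurePhase_of_real_odd {M : ℕ} {ψ : (Fin (M + 1) → Vec3) → ℂ}
    {R : Set (Fin M → Vec3)} (hR : MeasurableSet R) (hneg : ∀ q ∈ R, -q ∈ R)
    (him : ∀ q ∈ R, (ψ (conserve q)).im = 0)
    (hodd : ∀ q ∈ R, ψ (-conserve q) = -ψ (conserve q)) : IsPurePhase ψ R := by
  have : (volume : Measure Vec3).IsNegInvariant :=
    ⟨(LinearIsometryEquiv.neg ℝ (E := Vec3)).measurePreserving.map_eq⟩
  have : (volume : Measure (Fin M → Vec3)).IsNegInvariant :=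
    Measure.pi.isNegInvariant _
  have h1 : ∀ φ : 𝓢(Vec3, ℝ), ‖wavefunctionFactor ψ R φ‖ = 1 := by
    intro φ
    -- Substituting `q → -q` on the symmetric region shows that the integral is minus its conjugate.
    -- This holds even if the integral diverges, its value then being `0`.
    have h2 : ∫ q in R, phaseIntegrand ψ φ q =
        -(starRingEnd ℂ) (∫ q in R, phaseIntegrand ψ φ q) := by
      rw [← integral_conj, ← integral_neg, ← integral_indicator hR, ← integral_indicator hR,
        ← integral_neg_eq_self]
      congr 1
      funext q
      by_cases hq : q ∈ R
      · rw [Set.indicator_of_mem (hneg q hq), Set.indicator_of_mem hq,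
          phaseIntegrand_neg φ (him q hq) (hodd q hq)]
      · rw [Set.indicator_of_notMem hq, Set.indicator_of_notMem fun h => hq (by
          simpa using hneg _ h)]
    have h3 : (∫ q in R, phaseIntegrand ψ φ q).re = 0 := by
      have := congrArg Complex.re h2
      simp only [Complex.neg_re, Complex.conj_re] at this
      linarith
    have h4 : -(1 / ((M + 1).factorial : ℂ)) = ((-(1 / ((M + 1).factorial : ℝ)) : ℝ) : ℂ) := by
      push_cast; ring
    rw [wavefunctionFactor, Complex.norm_exp, h4, Complex.re_ofReal_mul, h3, mul_zero,
      Real.exp_zero]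
  refine ⟨h1, fun Ω _ μ φ Ψ₀ A => ?_⟩
  simp only [expectation, norm_mul, h1, mul_one]

theorem one_add_sum_le_prod_one_add {ι : Type*} (s : Finset ι) {f : ι → ℝ}
    (hf : ∀ i ∈ s, 0 ≤ f i) : 1 + ∑ i ∈ s, f i ≤ ∏ i ∈ s, (1 + f i) := by
  classical
  induction s using Finset.induction_on with
  | empty => simp
  | insert a s ha ih =>
    have ih := ih fun i hi => hf i (by simp [hi])
    have h1 := hf a (by simp)
    have h2 : 0 ≤ ∑ i ∈ s, f i := Finset.sum_nonneg fun i hi => hf i (by simp [hi])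
    rw [Finset.sum_insert ha, Finset.prod_insert ha]
    nlinarith

/-- The factor `2` accounts for the dependent momentum, whose norm is at most the sum of the others.
The product form makes the majorant of the momentum integral factorize. -/
theorem sum_norm_conserve_le {M : ℕ} (q : Fin M → Vec3) :
    ∑ i, ‖conserve q i‖ ≤ ∏ i, (1 + 2 * ‖q i‖) := by
  refine le_trans ?_ (one_add_sum_le_prod_one_add Finset.univ fun i _ => by positivity)
  rw [Fin.sum_univ_succ, ← Finset.mul_sum]
  simp only [conserve, Fin.cons_zero, Fin.cons_succ, norm_neg]
  linarith [norm_sum_le Finset.univ q]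

/-- `∫ ψ_N φ^N` converges absolutely if `ψ_N` is bounded by the scaling dimension `3`. -/
theorem integrable_phaseIntegrand {M : ℕ} {ψ : (Fin (M + 1) → Vec3) → ℂ} (hψ : Measurable ψ)
    {C : ℝ} (hC : 0 ≤ C) (hb : ∀ k, ‖ψ k‖ ≤ C * (∑ i, ‖k i‖) ^ 3) (φ : 𝓢(Vec3, ℝ)) :
    Integrable (phaseIntegrand ψ φ) := by
  obtain ⟨g, hg⟩ := exists_schwartz_eq_mode φ
  have hgc : Continuous (mode φ) := hg ▸ g.continuous
  -- The mode of the dependent momentum is only bounded by `B`; the other `M` modes supply the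
  -- decay.
  obtain ⟨B, hB, hBb⟩ := g.decay 0 0
  have hB' : ∀ k, ‖mode φ k‖ ≤ B := fun k => by
    simpa [hg] using hBb k
  have hint : Integrable fun k : Vec3 => (1 + 2 * ‖k‖) ^ 3 * ‖mode φ k‖ := by
    have h := fun n => hg ▸ g.integrable_pow_mul volume n
    have h' := ((h 0).const_mul 4).add ((h 3).const_mul 32)
    refine Integrable.mono' h' (by fun_prop) (Eventually.of_forall fun k => ?_)
    have hk := norm_nonneg k
    rw [Real.norm_of_nonneg (by positivity)]
    simp only [Pi.add_apply, pow_zero, one_mul]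
    -- With `x = 2‖k‖`, `4 + 4x³ - (1 + x)³ = 3(1 + x)(1 - x)²`.
    have : (1 + 2 * ‖k‖) ^ 3 ≤ 4 + 32 * ‖k‖ ^ 3 := by
      nlinarith [mul_nonneg (by positivity : 0 ≤ 1 + 2 * ‖k‖) (sq_nonneg (1 - 2 * ‖k‖))]
    calc _ ≤ (4 + 32 * ‖k‖ ^ 3) * ‖mode φ k‖ := by gcongr
      _ = _ := by ring
  have hprod : Integrable fun q : Fin M → Vec3 => ∏ i, ((1 + 2 * ‖q i‖) ^ 3 * ‖mode φ (q i)‖) :=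
    Integrable.fintype_prod (f := fun _ k => (1 + 2 * ‖k‖) ^ 3 * ‖mode φ k‖) fun _ => hint
  have hmeas : AEStronglyMeasurable (phaseIntegrand ψ φ) := by
    unfold phaseIntegrand
    refine Measurable.aestronglyMeasurable (Measurable.const_mul (Measurable.mul
      (hψ.comp continuous_conserve.measurable) (Continuous.measurable ?_)) _)
    refine continuous_finsetProd _ fun i _ => hgc.comp ?_
    exact (continuous_apply i).comp continuous_conserve
  refine Integrable.mono' (hprod.const_mul (‖((((2 * Real.pi) ^ 3) ^ M : ℝ) : ℂ)⁻¹‖ * C * B))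
    hmeas (Eventually.of_forall fun q => ?_)
  rw [phaseIntegrand, norm_mul, norm_mul, norm_prod, Fin.prod_univ_succ]
  have h1 : ‖ψ (conserve q)‖ ≤ C * ∏ i, (1 + 2 * ‖q i‖) ^ 3 := by
    rw [Finset.prod_pow]
    refine (hb _).trans ?_
    gcongr
    exact sum_norm_conserve_le q
  have h2 : ∏ i : Fin M, ‖mode φ (conserve q i.succ)‖ = ∏ i, ‖mode φ (q i)‖ := rfl
  rw [h2, Finset.prod_mul_distrib]
  calc _ ≤ ‖((((2 * Real.pi) ^ 3) ^ M : ℝ) : ℂ)⁻¹‖ *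
        ((C * ∏ i, (1 + 2 * ‖q i‖) ^ 3) * (B * ∏ i, ‖mode φ (q i)‖)) := by
        gcongr
        exact hB' _
    _ = _ := by ring

end

end DeSitter

/-! ### Contact diagrams, tree diagrams, pure phases and the trispectrum -/

theorem mainTheorem2 (H : ℝ) (hH : 0 < H) :
    -- contact diagrams of P-odd operators with `2m + n > 0`
    (∀ (N : ℕ) (O : DeSitter.LocalOperator N), O.IsOdd → 0 < 2 * O.m + O.n →
      ∀ k : Fin N → DeSitter.Vec3, (∀ i, k i ≠ 0) →
        (∀ σ : Equiv.Perm (Fin N),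
          (DeSitter.TreeDiagram.contact O σ).Converges H k ∧
          Filter.Tendsto
            (fun ε : ℝ => (DeSitter.TreeDiagram.contact O σ).regulated H k (DeSitter.contour ε))
            (nhdsWithin 0 (Set.Ioi 0))
            (nhds ((DeSitter.TreeDiagram.contact O σ).psi H k)) ∧
          ((DeSitter.TreeDiagram.contact O σ).psi H k).im = 0 ∧
          (DeSitter.TreeDiagram.contact O σ).psi H (-k) =
            -(DeSitter.TreeDiagram.contact O σ).psi H k) ∧
        (DeSitter.contactPsi H O k).im = 0 ∧
        DeSitter.contactPsi H O (-k) = -DeSitter.contactPsi H O k ∧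
        DeSitter.rePrime (DeSitter.contactPsi H O) k = 0 ∧
        DeSitter.correlator H (DeSitter.contactPsi H O) k = 0 ∧
        Filter.Tendsto (fun ε : ℝ => DeSitter.inInContact H O k ε)
          (nhdsWithin 0 (Set.Ioi 0)) (nhds 0)) ∧
    -- they are pure phases of the wavefunction
    (∀ (M : ℕ) (O : DeSitter.LocalOperator (M + 1)), O.IsOdd → 0 < 2 * O.m + O.n →
      (∀ φ : SchwartzMap DeSitter.Vec3 ℝ, MeasureTheory.Integrable
        (DeSitter.phaseIntegrand (DeSitter.contactPsi H O) φ)) ∧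
      DeSitter.IsPurePhase (DeSitter.contactPsi H O) Set.univ) ∧
    -- connected tree diagrams with an odd number of P-odd vertices
    (∀ (E : ℕ) (D : DeSitter.TreeDiagram E) (k : Fin E → DeSitter.Vec3), D.Generic k →
      (D.NonposPowers → D.Converges H k) ∧
      (Odd D.numOdd → D.Converges H k →
        Filter.Tendsto (fun ε : ℝ => D.regulated H k (DeSitter.contour ε))
          (nhdsWithin 0 (Set.Ioi 0)) (nhds (D.psi H k)) ∧
        (D.psi H k).im = 0 ∧
        D.psi H (-k) = -D.psi H k ∧
        DeSitter.rePrime (D.psi H) k = 0 ∧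
        DeSitter.correlator H (D.psi H) k = 0)) ∧
    -- any real combination of such diagrams is a pure phase of the wavefunction
    (∀ (M : ℕ) (ι : Type) (s : Finset ι) (c : ι → ℝ) (D : ι → DeSitter.TreeDiagram (M + 1))
        (R : Set (Fin M → DeSitter.Vec3)),
      MeasurableSet R → (∀ q ∈ R, -q ∈ R) →
      (∀ j ∈ s, Odd (D j).numOdd) →
      (∀ j ∈ s, ∀ q ∈ R, (D j).Generic (DeSitter.conserve q) ∧
        (D j).Converges H (DeSitter.conserve q)) →
      DeSitter.IsPurePhase (fun k => ∑ j ∈ s, (c j : ℂ) * (D j).psi H k) R) ∧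
    -- no trispectrum from P-odd four-scalar operators
    (∀ (ι : Type) (s : Finset ι) (O : ι → DeSitter.LocalOperator 4),
      (∀ j ∈ s, (O j).IsOdd ∧ 0 < 2 * (O j).m + (O j).n) →
      ∀ k : Fin 4 → DeSitter.Vec3, (∀ i, k i ≠ 0) →
        DeSitter.correlator H (fun p => ∑ j ∈ s, DeSitter.contactPsi H (O j) p) k = 0 ∧
        Filter.Tendsto (fun ε : ℝ => ∑ j ∈ s, DeSitter.inInContact H (O j) k ε)
          (nhdsWithin 0 (Set.Ioi 0)) (nhds 0)) := by
  open DeSitter in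
  refine ⟨fun N O hO h k hk => ⟨fun σ => ?_, im_contactPsi hH hO h k, contactPsi_neg H hO h k,
    rePrime_eq_zero (im_contactPsi hH hO h k) (contactPsi_neg H hO h k),
    correlator_eq_zero H (im_contactPsi hH hO h k) (contactPsi_neg H hO h k),
    tendsto_inInContact H hO h k⟩, fun M O hO h => ⟨fun φ => ?_, ?_⟩,
    fun E D k hD => ⟨TreeDiagram.converges_of_nonposPowers H hD, fun hodd hconv => ?_⟩,
    fun M ι s c D R hR hneg hodd hD => ?_, fun ι s O hO k _ => ⟨?_, ?_⟩⟩
  · have hconv := TreeDiagram.converges_contact H hO h σ hk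
    obtain ⟨h1, h2, h3⟩ := TreeDiagram.psi_of_converges hH
      (by rw [TreeDiagram.numOdd_contact hO]; exact odd_one) hconv
    exact ⟨hconv, h1, h2, h3⟩
  · obtain ⟨C, hC, hb⟩ := exists_norm_contactPsi_le H hO h
    exact integrable_phaseIntegrand (measurable_contactPsi H hO h) hC hb φ
  · exact isPurePhase_of_real_odd MeasurableSet.univ (fun _ _ => trivial)
      (fun q _ => im_contactPsi hH hO h _) fun q _ => contactPsi_neg H hO h _
  · obtain ⟨h1, h2, h3⟩ := TreeDiagram.psi_of_converges hH hodd hconv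
    exact ⟨h1, h2, h3, rePrime_eq_zero h2 h3, correlator_eq_zero H h2 h3⟩
  · refine isPurePhase_of_real_odd hR hneg (fun q hq => ?_) fun q hq => ?_
    · rw [Complex.im_sum]
      refine Finset.sum_eq_zero fun j hj => ?_
      rw [Complex.im_ofReal_mul,
        (TreeDiagram.psi_of_converges hH (hodd j hj) (hD j hj q hq).2).2.1, mul_zero]
    · rw [← Finset.sum_neg_distrib]
      refine Finset.sum_congr rfl fun j hj => ?_
      rw [(TreeDiagram.psi_of_converges hH (hodd j hj) (hD j hj q hq).2).2.2, mul_neg]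
  · refine correlator_eq_zero H ?_ ?_
    · rw [Complex.im_sum]
      exact Finset.sum_eq_zero fun j hj => im_contactPsi hH (hO j hj).1 (hO j hj).2 k
    · rw [← Finset.sum_neg_distrib]
      exact Finset.sum_congr rfl fun j hj => contactPsi_neg H (hO j hj).1 (hO j hj).2 k
  · simpa using tendsto_finsetSum s fun j hj =>
      tendsto_inInContact H (hO j hj).1 (hO j hj).2 k
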